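/- **Setting.** For $l\in\tfrac12\mathbb{N}$ let $R_l$ be the irreducible representation of $SL(2,\mathbb{C})$ on binary forms of degree $2l$ in $x_0,x_1$, where $g$ acts by $x_j\mapsto\sum_i g_{ij}x_i$, with canonical basis $e_{l,m}=\binom{2l}{l+m}^{1/2}x_0^{l+m}x_1^{l-m}$, $m=-l,-l+1,\dots,l$. Restricted to $SU(2)$ this is the irrep of spin $l$. A *Clebsch–Gordan (CG) map* of $SU(2)$ is an isomorphism of $SU(2)$-representations $$B:\bigoplus_{l=|l_1-l_2|}^{l_1+l_2}\widetilde R_l\to R_{l_1}\otimes R_{l_2}$$ (unit steps in $l$, each $\widetilde R_l$ a copy of $R_l$ with canonical basis $\tilde e_{l,m}$) whose matrix in the canonical bases is real orthogonal; its coefficients are defined by $B\tilde e_{l,m}=\sum_{m_1,m_2}B^{l_1,m_1;l_2,m_2}_{l,m}\,e_{l_1,m_1}\otimes e_{l_2,m_2}$. For $k,n\in\mathbb{N}$ let $T^{(k,n)}=R_{k/2}\otimes\overline R_{n/2}$ be the representation of $SL(2,\mathbb{C})$ in which $g$ acts on the first factor as on $R_{k/2}$ and on the second as $\epsilon\bar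 g\epsilon^{-1}$ acts on $R_{n/2}$, where $\epsilon=\begin{pmatrix}0&1\\-1&0\end{pmatrix}$. On $SU(2)$ it coincides with $R_{k/2}\otimes R_{n/2}$. Given a choice of CG maps of $SU(2)$ for all pairs of spins, the canonical basis of $T^{(k,n)}$ is $$e^{(k,n)}_{l,m}=\sum_{a,b}B^{\frac k2,a;\frac n2,b}_{l,m}\,e_{\frac k2,a}\otimes e_{\frac n2,b},\qquad l=\tfrac{|k-n|}2,\dots,\tfrac{k+n}2,\quad m=-l,\dots,l .$$ A *CG map of the Lorentz group* is an isomorphism of $SL(2,\mathbb{C})$-representations $$H:\bigoplus_{k,n}\widetilde T^{(k,n)}\to T^{(k_1,n_1)}\otimes T^{(k_2,n_2)},\qquad k=|k_1-k_2|,|k_1-k_2|+2,\dots,k_1+k_2,\quad n=|n_1-n_2|,|n_1-n_2|+2,\dots,n_1+n_2,$$ with coefficients defined by $H\tilde e^{(k,n)}_{l,m}=\sum H^{(k_1,n_1),l_1,m_1;(k_2,n_2),l_2,m_2}_{(k,n),l,m}\,e^{(k_1,n_1)}_{l_1,m_1}\otimes e^{(k_2,n_2)}_{l_2,m_2}$.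 **Theorem.** CG maps of $SU(2)$ exist for all pairs of spins. Fix any choice of them. Then: 1. $B^{l_1,m_1;l_2,m_2}_{l,m}=0$ unless $m_1+m_2=m$, and the inverse map has the same coefficients: $e_{l_1,m_1}\otimes e_{l_2,m_2}$, mapped back by $B^{-1}$, equals $\sum_{l,m}B^{l_1,m_1;l_2,m_2}_{l,m}\,\tilde e_{l,m}$, i.e. $(B^{-1})^{l,m}_{l_1,m_1;l_2,m_2}=B^{l_1,m_1;l_2,m_2}_{l,m}$. 2. For fixed $k,n,l$, the vectors $e^{(k,n)}_{l,m}$ are transformed by $SU(2)$ exactly as the vectors $e_{l,m}$ of $R_l$. 3. For all $k_1,n_1,k_2,n_2\in\mathbb{N}$ there is a CG map $H$ of the Lorentz group with coefficients $$\begin{aligned}H^{(k_1,n_1),l_1,m_1;(k_2,n_2),l_2,m_2}_{(k,n),l,m}=\sum_{m_1',m_2'}&B^{\frac k2,m_1'+m_2';\frac n2,m-m_1'-m_2'}_{l,m}\,B^{\frac{k_1}2,m_1';\frac{k_2}2,m_2'}_{\frac k2,m_1'+m_2'}\,B^{\frac{n_1}2,m_1-m_1';\frac{n_2}2,m_2-m_2'}_{\frac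 n2,m-m_1'-m_2'}\\&\times B^{\frac{k_1}2,m_1';\frac{n_1}2,m_1-m_1'}_{l_1,m_1}\,B^{\frac{k_2}2,m_2';\frac{n_2}2,m_2-m_2'}_{l_2,m_2},\end{aligned}$$ where $m_1'$ and $m_2'$ run over the weights $-\frac{k_1}2,-\frac{k_1}2+1,\dots,\frac{k_1}2$ and $-\frac{k_2}2,-\frac{k_2}2+1,\dots,\frac{k_2}2$ subject to $-\frac k2\le m_1'+m_2'\le\frac k2$, $m-\frac n2\le m_1'+m_2'\le m+\frac n2$, $m_1-\frac{n_1}2\le m_1'\le\frac{n_1}2+m_1$ and $m_2-\frac{n_2}2\le m_2'\le\frac{n_2}2+m_2$. 4. The matrix of this $H$ in the canonical bases is real orthogonal, and its coefficients vanish unless $m_1+m_2=m$. Every other CG map of the Lorentz group for the same $k_1,n_1,k_2,n_2$ has coefficients obtained from these by multiplication with a nonzero constant $c_{(k,n)}\in\mathbb{C}$ for each $(k,n)$, and $c_{(k,n)}=\pm1$ if its matrix in the canonical bases is real orthogonal. -/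

import Mathlib

open scoped TensorProduct DirectSum Matrix

noncomputable section

namespace LorentzCG

/-! Half-integers are stored doubled: the natural number `a` stands for the spin `a / 2`,
and the integer `p` stands for the magnetic number `p / 2`. -/

/-- The doubled magnetic numbers `-a, -a + 2, …, a` of spin `a / 2`. -/
def weights (a : ℕ) : Finset ℤ := (Finset.range (a + 1)).image fun i : ℕ => 2 * (i : ℤ) - a

/-- The doubled spins `|a - b|, |a - b| + 2, …, a + b`. -/
def spins (a b : ℕ) : Finset ℕ := (Finset.range (min a b + 1)).image fun i : ℕ => a + b - 2 * i

/-- The underlying space of the irrep of spin `a / 2`: binary forms of degree `a`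
in the variables `X 0, X 1`. -/
abbrev Spin (a : ℕ) : Type := MvPolynomial.homogeneousSubmodule (Fin 2) ℂ a

/-- The group `SL(2, ℂ)`. -/
abbrev SL2C : Type := Matrix.SpecialLinearGroup (Fin 2) ℂ

/-- The group `SU(2)`. -/
abbrev SU2 : Type := Matrix.specialUnitaryGroup (Fin 2) ℂ

/-- The linear substitution `X j ↦ ∑ i, g i j • X i` on polynomials. -/
def substitution (g : Matrix (Fin 2) (Fin 2) ℂ) :
    MvPolynomial (Fin 2) ℂ →ₐ[ℂ] MvPolynomial (Fin 2) ℂ :=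
  MvPolynomial.aeval fun j => ∑ i, MvPolynomial.C (g i j) * MvPolynomial.X i

theorem substitution_one : substitution 1 = AlgHom.id ℂ _ := by
  apply MvPolynomial.algHom_ext
  intro j
  fin_cases j <;> simp [substitution]

theorem substitution_mul (g h : Matrix (Fin 2) (Fin 2) ℂ) :
    substitution (g * h) = (substitution g).comp (substitution h) := by
  apply MvPolynomial.algHom_ext
  intro j
  simp [substitution, Matrix.mul_apply, Fin.sum_univ_two, MvPolynomial.algHom_C]
  ring

theorem substitution_mem (g : Matrix (Fin 2) (Fin 2) ℂ) (a : ℕ)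
    (f : MvPolynomial (Fin 2) ℂ) (hf : f ∈ MvPolynomial.homogeneousSubmodule (Fin 2) ℂ a) :
    substitution g f ∈ MvPolynomial.homogeneousSubmodule (Fin 2) ℂ a := by
  rw [MvPolynomial.mem_homogeneousSubmodule] at hf ⊢
  have h := hf.aeval (S := ℂ) (n := 1)
    (fun j => ∑ i, MvPolynomial.C (g i j) * MvPolynomial.X i)
    (fun j => MvPolynomial.IsHomogeneous.sum _ _ _ fun i _ => by
      simpa using (MvPolynomial.isHomogeneous_C (Fin 2) (g i j)).mul
        (MvPolynomial.isHomogeneous_X ℂ i))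
  simpa [substitution] using h

/-- The irrep of `SL(2, ℂ)` of spin `a / 2` (the analytic continuation of the Wigner matrices
`D^{a/2}`), namely the `a`-th symmetric power of the defining representation.
For `a = 1` the matrix of `g` in the basis `X 0, X 1` is `g` itself. -/
def spinRep (a : ℕ) : Representation ℂ SL2C (Spin a) where
  toFun g := (substitution g.1).toLinearMap.restrict (substitution_mem g.1 a)
  map_one' := by
    ext f
    simp [substitution_one]
  map_mul' g h := by
    apply LinearMap.ext
    intro f
    apply Subtype.ext
    change substitution (g * h).1 f.1 = substitution g.1 (substitution h.1 f.1)
    rw [Matrix.SpecialLinearGroup.coe_mul, substitution_mul]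
    rfl

/-- The exponents of the monomial of degree `a` and weight `p`. -/
def expo (a : ℕ) (p : ℤ) : Fin 2 →₀ ℕ :=
  Finsupp.single 0 ((a + p) / 2).toNat + Finsupp.single 1 ((a - p) / 2).toNat

theorem expo_degree (a : ℕ) (p : ℤ) (hp : p ∈ weights a) : (expo a p).degree = a := by
  simp only [weights, Finset.mem_image, Finset.mem_range] at hp
  obtain ⟨i, hi, rfl⟩ := hp
  simp [expo, Finsupp.degree_single]
  omega

/-- The canonical vector `e_{l,m} = √(2l choose l+m) X₀ ^ (l+m) X₁ ^ (l-m)`,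
where `l = a / 2` and `m = p / 2`. -/
def spinVec (a : ℕ) (p : weights a) : Spin a :=
  ⟨MvPolynomial.monomial (expo a p) (√(a.choose ((a + (p : ℤ)) / 2).toNat : ℝ) : ℂ), by
    rw [MvPolynomial.mem_homogeneousSubmodule]
    exact MvPolynomial.isHomogeneous_monomial _ (expo_degree a p p.2)⟩

theorem normalization_ne_zero (a : ℕ) (p : weights a) :
    (√(a.choose ((a + (p : ℤ)) / 2).toNat : ℝ) : ℂ) ≠ 0 := by
  obtain ⟨p, hp⟩ := p
  simp only [weights, Finset.mem_image, Finset.mem_range] at hp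
  obtain ⟨i, hi, rfl⟩ := hp
  have h : 0 < a.choose ((a + (2 * (i : ℤ) - a)) / 2).toNat := Nat.choose_pos (by omega)
  have h' : (0 : ℝ) < √(a.choose ((a + (2 * (i : ℤ) - a)) / 2).toNat : ℝ) :=
    Real.sqrt_pos.2 (by exact_mod_cast h)
  exact_mod_cast h'.ne'

theorem expo_injective (a : ℕ) : Function.Injective fun p : weights a => expo a p := by
  rintro ⟨p, hp⟩ ⟨q, hq⟩ h
  simp only [weights, Finset.mem_image, Finset.mem_range] at hp hq
  obtain ⟨i, hi, rfl⟩ := hp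
  obtain ⟨j, hj, rfl⟩ := hq
  have h0 := DFunLike.congr_fun h 0
  simp [expo] at h0
  simp only [Subtype.mk.injEq]
  omega

theorem spinVec_linearIndependent (a : ℕ) : LinearIndependent ℂ (spinVec a) := by
  have h1 : LinearIndependent ℂ fun p : weights a =>
      (MvPolynomial.monomial (expo a p) (1 : ℂ) : MvPolynomial (Fin 2) ℂ) := by
    have := (MvPolynomial.basisMonomials (Fin 2) ℂ).linearIndependent.comp _ (expo_injective a)
    simpa [Function.comp_def] using this
  have h2 := h1.units_smul fun p => Units.mk0 _ (normalization_ne_zero a p)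
  refine LinearIndependent.of_comp (MvPolynomial.homogeneousSubmodule (Fin 2) ℂ a).subtype ?_
  have h3 : (MvPolynomial.homogeneousSubmodule (Fin 2) ℂ a).subtype ∘ spinVec a =
      (fun p => Units.mk0 _ (normalization_ne_zero a p)) •
        fun p : weights a => (MvPolynomial.monomial (expo a p) (1 : ℂ) :
          MvPolynomial (Fin 2) ℂ) := by
    funext p
    simp [spinVec, MvPolynomial.smul_monomial, Units.smul_def]
  rw [h3]
  exact h2

theorem spinVec_span (a : ℕ) : ⊤ ≤ Submodule.span ℂ (Set.range (spinVec a)) := by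
  rintro ⟨f, hf⟩ -
  have hmap : f ∈ (Submodule.span ℂ (Set.range (spinVec a))).map
      (MvPolynomial.homogeneousSubmodule (Fin 2) ℂ a).subtype := by
    rw [MvPolynomial.mem_homogeneousSubmodule] at hf
    rw [f.as_sum]
    refine Submodule.sum_mem _ fun d hd => ?_
    have hdeg : d.degree = a := by
      have := hf (MvPolynomial.mem_support_iff.1 hd)
      rw [Finsupp.degree_eq_weight_one]
      exact this
    have hsum : d 0 + d 1 = a := by
      rw [← hdeg, Finsupp.degree_eq_sum, Fin.sum_univ_two]
    let p : weights a := ⟨2 * (d 0 : ℤ) - a, by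
      simp only [weights, Finset.mem_image, Finset.mem_range]
      exact ⟨d 0, by omega, rfl⟩⟩
    have hexp : expo a p = d := by
      ext i
      fin_cases i
      · simp [expo, p]
      · simp [expo, p]
        omega
    refine ⟨(MvPolynomial.coeff d f * (√(a.choose ((a + (p : ℤ)) / 2).toNat : ℝ) : ℂ)⁻¹) •
      spinVec a p, Submodule.smul_mem _ _ (Submodule.subset_span ⟨p, rfl⟩), ?_⟩
    have hn := normalization_ne_zero a p
    simp only [map_smul, Submodule.subtype_apply, spinVec, hexp, MvPolynomial.smul_monomial,
      smul_eq_mul]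
    rw [mul_assoc, inv_mul_cancel₀ hn, mul_one]
  obtain ⟨v, hv, hvf⟩ := hmap
  have : v = ⟨f, hf⟩ := Subtype.ext hvf
  rwa [← this]

/-- The canonical basis `e_{l,m}`, `m = -l, …, l`, of the irrep of spin `l = a / 2`. -/
def spinBasis (a : ℕ) : Module.Basis (weights a) ℂ (Spin a) :=
  Module.Basis.mk (spinVec_linearIndependent a) (spinVec_span a)

/-- The inclusion of `SU(2)` in `SL(2, ℂ)`. -/
def incl : SU2 →* SL2C where
  toFun u := ⟨u.1, (Matrix.mem_specialUnitaryGroup_iff.1 u.2).2⟩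
  map_one' := rfl
  map_mul' _ _ := rfl

/-- The irrep `R_{a/2}` of `SU(2)`. -/
def su2Rep (a : ℕ) : Representation ℂ SU2 (Spin a) := (spinRep a).comp incl

/-- The two-dimensional Levi-Civita tensor. -/
def epsilon : SL2C := ⟨!![0, 1; -1, 0], by simp [Matrix.det_fin_two]⟩

/-- The conjugate fundamental representation `g ↦ ε ḡ ε⁻¹`. -/
def conjHom : SL2C →* SL2C :=
  (MulAut.conj epsilon).toMonoidHom.comp (Matrix.SpecialLinearGroup.map (starRingEnd ℂ))

/-- The space of `T^{(k,n)}`. -/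
abbrev TSpace (k n : ℕ) : Type := Spin k ⊗[ℂ] Spin n

/-- The irrep `T^{(k,n)}` of `SL(2, ℂ)`: spin `k / 2` tensored with the conjugated spin `n / 2`. -/
def TRep (k n : ℕ) : Representation ℂ SL2C (TSpace k n) :=
  (spinRep k).tprod ((spinRep n).comp conjHom)

/-! ### The Clebsch–Gordan maps of `SU(2)` -/

/-- The direct sum of the `R_l` with `l = |l₁ - l₂|, …, l₁ + l₂`, where `l₁ = a / 2`
and `l₂ = b / 2`. -/
abbrev SumSpace (a b : ℕ) : Type := ⨁ c : spins a b, Spin c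

/-- The action of `SU(2)` on the direct sum of the `R_l`. -/
def sumRep (a b : ℕ) : Representation ℂ SU2 (SumSpace a b) :=
  Representation.directSum fun c : spins a b => su2Rep c

/-- The canonical basis `ẽ_{l,m}` of the direct sum of the `R_l`. -/
def sumBasis (a b : ℕ) : Module.Basis (Σ c : spins a b, weights c) ℂ (SumSpace a b) :=
  DFinsupp.basis fun c : spins a b => spinBasis c

/-- The basis `e_{l₁,m₁} ⊗ e_{l₂,m₂}`. -/
def prodBasis (a b : ℕ) : Module.Basis (weights a × weights b) ℂ (Spin a ⊗[ℂ] Spin b) :=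
  (spinBasis a).tensorProduct (spinBasis b)

/-- A matrix with complex entries is real orthogonal. -/
def IsRealOrthogonal {ι κ : Type} [Fintype ι] [Fintype κ] [DecidableEq ι] [DecidableEq κ]
    (M : Matrix ι κ ℂ) : Prop :=
  (∀ i j, (M i j).im = 0) ∧ Mᵀ * M = 1 ∧ M * Mᵀ = 1

/-- A choice, for all spins `a / 2` and `b / 2`, of a Clebsch–Gordan map
`B : ⨁ R_l → R_{a/2} ⊗ R_{b/2}`: an isomorphism of representations of `SU(2)` that is
orthogonal in the canonical bases. (Such a map is unique up to a sign for each `l`.) -/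
structure CGChoice where
  map (a b : ℕ) : (sumRep a b).Equiv ((su2Rep a).tprod (su2Rep b))
  orthogonal (a b : ℕ) :
    IsRealOrthogonal (LinearMap.toMatrix (sumBasis a b) (prodBasis a b)
      (map a b).toLinearEquiv.toLinearMap)

/-- The coefficient `B^{a/2, p/2; b/2, q/2}_{c/2, r/2}`: the component of the image of
`ẽ_{c/2, r/2}` along `e_{a/2, p/2} ⊗ e_{b/2, q/2}`; zero for indices out of range. -/
def CGChoice.coeff (B : CGChoice) (a : ℕ) (p : ℤ) (b : ℕ) (q : ℤ) (c : ℕ) (r : ℤ) : ℂ :=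
  if h : (p ∈ weights a ∧ q ∈ weights b) ∧ c ∈ spins a b ∧ r ∈ weights c then
    (prodBasis a b).repr (B.map a b (sumBasis a b ⟨⟨c, h.2.1⟩, ⟨r, h.2.2⟩⟩))
      (⟨p, h.1.1⟩, ⟨q, h.1.2⟩)
  else 0

/-! ### The Clebsch–Gordan maps of the Lorentz group -/

/-- The canonical basis `e^{(k,n)}_{l,m}` of `T^{(k,n)}`. As a representation of `SU(2)` the
latter is `R_{k/2} ⊗ R_{n/2}`, and the basis is the image of the basis `ẽ_{l,m}` of the direct
sum of the `R_l` under the Clebsch–Gordan map of `SU(2)`. -/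
def CGChoice.basis (B : CGChoice) (k n : ℕ) :
    Module.Basis (Σ c : spins k n, weights c) ℂ (TSpace k n) :=
  (sumBasis k n).map (B.map k n).toLinearEquiv

/-- The direct sum of the `T^{(k,n)}` over `k = |k₁ - k₂|, …, k₁ + k₂` and
`n = |n₁ - n₂|, …, n₁ + n₂`, both with step two. -/
abbrev TSumSpace (k₁ n₁ k₂ n₂ : ℕ) : Type :=
  ⨁ s : spins k₁ k₂ × spins n₁ n₂, TSpace s.1 s.2

/-- The action of `SL(2, ℂ)` on the direct sum of the `T^{(k,n)}`. -/
def TSumRep (k₁ n₁ k₂ n₂ : ℕ) : Representation ℂ SL2C (TSumSpace k₁ n₁ k₂ n₂) :=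
  Representation.directSum fun s : spins k₁ k₂ × spins n₁ n₂ => TRep s.1 s.2

/-- The type of the Clebsch–Gordan maps of the Lorentz group: isomorphisms
`⨁ T^{(k,n)} → T^{(k₁,n₁)} ⊗ T^{(k₂,n₂)}` of representations of `SL(2, ℂ)`. -/
abbrev LorentzCGMap (k₁ n₁ k₂ n₂ : ℕ) : Type :=
  (TSumRep k₁ n₁ k₂ n₂).Equiv ((TRep k₁ n₁).tprod (TRep k₂ n₂))

/-- The indices `(l₁, m₁), (l₂, m₂)`. -/
abbrev RowIndex (k₁ n₁ k₂ n₂ : ℕ) : Type :=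
  (Σ c : spins k₁ n₁, weights c) × (Σ c : spins k₂ n₂, weights c)

/-- The indices `(k, n), (l, m)`. -/
abbrev ColIndex (k₁ n₁ k₂ n₂ : ℕ) : Type :=
  Σ s : spins k₁ k₂ × spins n₁ n₂, Σ c : spins s.1 s.2, weights c

/-- The canonical basis `ẽ^{(k,n)}_{l,m}` of the direct sum of the `T^{(k,n)}`. -/
def CGChoice.sumBasis (B : CGChoice) (k₁ n₁ k₂ n₂ : ℕ) :
    Module.Basis (ColIndex k₁ n₁ k₂ n₂) ℂ (TSumSpace k₁ n₁ k₂ n₂) :=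
  DFinsupp.basis fun s : spins k₁ k₂ × spins n₁ n₂ => B.basis s.1 s.2

/-- The basis `e^{(k₁,n₁)}_{l₁,m₁} ⊗ e^{(k₂,n₂)}_{l₂,m₂}`. -/
def CGChoice.prodBasis (B : CGChoice) (k₁ n₁ k₂ n₂ : ℕ) :
    Module.Basis (RowIndex k₁ n₁ k₂ n₂) ℂ (TSpace k₁ n₁ ⊗[ℂ] TSpace k₂ n₂) :=
  (B.basis k₁ n₁).tensorProduct (B.basis k₂ n₂)

/-- The Clebsch–Gordan coefficients of a Clebsch–Gordan map `H` of the Lorentz group: its matrix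
in the canonical bases. -/
def CGChoice.lorentzCoeff (B : CGChoice) {k₁ n₁ k₂ n₂ : ℕ} (H : LorentzCGMap k₁ n₁ k₂ n₂) :
    Matrix (RowIndex k₁ n₁ k₂ n₂) (ColIndex k₁ n₁ k₂ n₂) ℂ := fun i j =>
  (B.prodBasis k₁ n₁ k₂ n₂).repr (H (B.sumBasis k₁ n₁ k₂ n₂ j)) i

/-- The range of summation: the pairs `(m₁', m₂')` (stored doubled). -/
def sumRange (k₁ n₁ k₂ n₂ : ℕ) (m₁ m₂ : ℤ) (k n : ℕ) (m : ℤ) : Finset (ℤ × ℤ) :=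
  (weights k₁ ×ˢ weights k₂).filter fun x =>
    (-(k : ℤ) ≤ x.1 + x.2 ∧ x.1 + x.2 ≤ k) ∧ (m - n ≤ x.1 + x.2 ∧ x.1 + x.2 ≤ m + n) ∧
    (m₁ - n₁ ≤ x.1 ∧ x.1 ≤ n₁ + m₁) ∧ (m₂ - n₂ ≤ x.2 ∧ x.2 ≤ n₂ + m₂)

/-- The sum over `(m₁', m₂')` of products of five coefficients of `SU(2)`. All the arguments
`l₁ m₁ l₂ m₂ l m` are stored doubled. -/
def CGChoice.formula (B : CGChoice) (k₁ n₁ l₁ : ℕ) (m₁ : ℤ) (k₂ n₂ l₂ : ℕ) (m₂ : ℤ)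
    (k n l : ℕ) (m : ℤ) : ℂ :=
  ∑ x ∈ sumRange k₁ n₁ k₂ n₂ m₁ m₂ k n m,
    B.coeff k (x.1 + x.2) n (m - x.1 - x.2) l m *
    B.coeff k₁ x.1 k₂ x.2 k (x.1 + x.2) *
    B.coeff n₁ (m₁ - x.1) n₂ (m₂ - x.2) n (m - x.1 - x.2) *
    B.coeff k₁ x.1 n₁ (m₁ - x.1) l₁ m₁ *
    B.coeff k₂ x.2 n₂ (m₂ - x.2) l₂ m₂

/-- The matrix of all values of the formula. -/
def CGChoice.formulaMatrix (B : CGChoice) (k₁ n₁ k₂ n₂ : ℕ) :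
    Matrix (RowIndex k₁ n₁ k₂ n₂) (ColIndex k₁ n₁ k₂ n₂) ℂ := fun i j =>
  B.formula k₁ n₁ i.1.1 i.1.2 k₂ n₂ i.2.1 i.2.2 j.1.1 j.1.2 j.2.1 j.2.2

end LorentzCG

end

open scoped TensorProduct DirectSum Matrix

noncomputable section

namespace LorentzCG

open scoped Kronecker

/-! Existence for `SU(2)`. The canonical basis is orthogonal with constant norm for the pairing in
which multiplication by a variable is adjoint to its derivative, so transposing `g` transposes its
matrix (`wigner_transpose`). Transvectants supply a nonzero real intertwiner onto each spin
(`exists_real_intertwiner`). Its transpose is again an intertwiner, and Schur's lemma together with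
reality lets it be rescaled to an isometry. Different spins are orthogonal, again by Schur, and a
dimension count makes the assembled matrix square.

An arbitrary choice of CG maps is equivariant only under `SU(2)`. The diagonal circle already forces
conservation of weights, hence equivariance under all diagonal matrices; these and `SU(2)` generate
`SL(2, ℂ)`, so the maps are `SL(2, ℂ)`-equivariant (`mapSpin_comp_spinRep`).

The Lorentz map decomposes the two unconjugated factors and the two conjugated factors separately,
then exchanges the middle tensor factors. Its matrix in the canonical bases is a product of matrices
built from orthogonal CG matrices (`lorentzCoeff_lorentzMap_eq_mul`), hence orthogonal. Expanding
the product gives a sixfold sum that weight conservation collapses to the stated double sum.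

Uniqueness is Schur's lemma for `T^{(k,n)}`. An intertwiner preserves both weights separately, hence
commutes with the diagonal matrices acting on one factor alone. The elements whose one-sided action
it commutes with form a subgroup normalized by `SU(2)`, which therefore contains the unipotents
(`upper_mem_of_normalized`). The slices of the intertwiner are then covered by Schur's lemma for
single spins. -/

theorem mem_weights {a : ℕ} {p : ℤ} : p ∈ weights a ↔ -(a : ℤ) ≤ p ∧ p ≤ a ∧ (p + a) % 2 = 0 := by
  simp only [weights, Finset.mem_image, Finset.mem_range]
  constructor
  · rintro ⟨i, hi, rfl⟩
    omega
  · intro h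
    exact ⟨((p + a) / 2).toNat, by omega, by omega⟩

theorem mem_spins {a b c : ℕ} :
    c ∈ spins a b ↔ a ≤ b + c ∧ b ≤ a + c ∧ c ≤ a + b ∧ (a + b + c) % 2 = 0 := by
  simp only [spins, Finset.mem_image, Finset.mem_range]
  constructor
  · rintro ⟨i, hi, rfl⟩
    omega
  · intro h
    exact ⟨(a + b - c) / 2, by omega, by omega⟩

/-! ### Generators of `SL(2, ℂ)` and the passage between equivariance and weights -/

/-- The diagonal matrix with entries `z` and `z⁻¹`. -/
def torus (z : ℂˣ) : SL2C := ⟨!![(z : ℂ), 0; 0, (z : ℂ)⁻¹], by simp [Matrix.det_fin_two]⟩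

/-- The upper unipotent matrix with entry `t`. -/
def upper (t : ℂ) : SL2C := ⟨!![1, t; 0, 1], by simp [Matrix.det_fin_two]⟩

theorem coe_torus (z : ℂˣ) : (torus z).1 = !![(z : ℂ), 0; 0, (z : ℂ)⁻¹] := rfl

theorem coe_upper (t : ℂ) : (upper t).1 = !![1, t; 0, 1] := rfl

theorem torus_mul_upper (z : ℂˣ) (t : ℂ) :
    torus z * upper t = upper ((z : ℂ) ^ 2 * t) * torus z := by
  have := z.ne_zero
  apply Subtype.ext
  ext i j
  fin_cases i <;> fin_cases j <;>
    simp [coe_torus, coe_upper, Matrix.SpecialLinearGroup.coe_mul]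
  field_simp

/-- The element of `SU(2)` with first column `(α, γ)`. -/
def su2OfColumn (α γ : ℂ) (h : α * star α + γ * star γ = 1) : SU2 :=
  ⟨!![α, -star γ; γ, star α], by
    rw [Matrix.mem_specialUnitaryGroup_iff]
    refine ⟨Matrix.mem_unitaryGroup_iff'.2 ?_, ?_⟩
    · ext i j
      fin_cases i <;> fin_cases j <;>
        simp [Matrix.mul_apply, Fin.sum_univ_two, Matrix.star_apply] at h ⊢
      · linear_combination h
      · ring
      · ring
      · linear_combination h
    · simp [Matrix.det_fin_two] at h ⊢
      linear_combination h⟩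

theorem coe_incl_su2OfColumn (α γ : ℂ) (h : α * star α + γ * star γ = 1) :
    (incl (su2OfColumn α γ h)).1 = !![α, -star γ; γ, star α] := rfl

/-- Conjugation by `torus z` multiplies the unipotent parameter by `z ^ 2`, and every complex number
is a square. -/
theorem upper_mem_of_ne_zero {S : Subgroup SL2C} (hT : ∀ z, torus z ∈ S) {w : ℂ} (hw : w ≠ 0)
    (h : upper w ∈ S) (t : ℂ) : upper t ∈ S := by
  rcases eq_or_ne t 0 with rfl | ht
  · convert S.one_mem
    apply Subtype.ext
    ext i j
    fin_cases i <;> fin_cases j <;> simp [coe_upper]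
  · obtain ⟨z, hz⟩ := IsAlgClosed.exists_pow_nat_eq (t / w) (n := 2) (by norm_num)
    have hz0 : z ≠ 0 := by
      rintro rfl
      rw [eq_div_iff hw] at hz
      simp at hz
      exact ht hz.symm
    have h1 := torus_mul_upper (Units.mk0 z hz0) w
    rw [Units.val_mk0, hz, div_mul_cancel₀ _ hw] at h1
    rw [eq_mul_inv_of_mul_eq h1.symm]
    exact S.mul_mem (S.mul_mem (hT _) h) (S.inv_mem (hT _))

/-- `SL(2, ℂ)` is generated by `SU(2)` and the diagonal matrices. -/
theorem eq_top_of_su2_of_torus {S : Subgroup SL2C} (hK : ∀ u : SU2, incl u ∈ S)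
    (hT : ∀ z, torus z ∈ S) : S = ⊤ := by
  have hU : ∀ t, upper t ∈ S := by
    -- A singular value decomposition with rational entries: the singular values are `4 / 3` and `3
    -- / 4`, whose difference is `7 / 12`, and the rotations come from the triple 3, 4, 5.
    refine upper_mem_of_ne_zero hT (w := -7 / 12) (by norm_num) ?_
    let k₁ : SU2 := su2OfColumn (4 / 5) (-3 / 5) (by simp; norm_num)
    let k₂ : SU2 := su2OfColumn (3 / 5) (4 / 5) (by simp; norm_num)
    have : upper (-7 / 12) = incl k₁ * torus (Units.mk0 (4 / 3) (by norm_num)) * incl k₂ := by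
      apply Subtype.ext
      ext i j
      fin_cases i <;> fin_cases j <;>
        simp [k₁, k₂, coe_incl_su2OfColumn, coe_upper, coe_torus,
          Matrix.SpecialLinearGroup.coe_mul] <;>
        norm_num
    rw [this]
    exact S.mul_mem (S.mul_mem (hK _) (hT _)) (hK _)
  rw [eq_top_iff]
  intro g _
  set α := g.1 0 0 with hα
  set γ := g.1 1 0 with hγ
  have hdet : α * g.1 1 1 - g.1 0 1 * γ = 1 := by
    rw [← Matrix.det_fin_two, g.2]
  have hpos : 0 < Complex.normSq α + Complex.normSq γ := by
    rcases eq_or_ne α 0 with h0 | h0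
    · have : γ ≠ 0 := by
        intro h1
        simp [h0, h1] at hdet
      have := Complex.normSq_pos.2 this
      have := Complex.normSq_nonneg α
      linarith
    · have := Complex.normSq_pos.2 h0
      have := Complex.normSq_nonneg γ
      linarith
  set r : ℝ := √(Complex.normSq α + Complex.normSq γ) with hr
  have hr0 : (r : ℂ) ≠ 0 := by exact_mod_cast (Real.sqrt_pos.2 hpos).ne'
  have hrr : (r : ℂ) ^ 2 = α * star α + γ * star γ := by
    have : r ^ 2 = Complex.normSq α + Complex.normSq γ := Real.sq_sqrt hpos.le
    have h2 : (r : ℂ) ^ 2 = ((Complex.normSq α + Complex.normSq γ : ℝ) : ℂ) := by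
      rw [← this]; push_cast; rfl
    rw [h2]
    push_cast
    rw [← Complex.mul_conj, ← Complex.mul_conj]
    rfl
  let k : SU2 := su2OfColumn (α / r) (γ / r) (by
    simp only [star_div₀]
    have : star (r : ℂ) = r := Complex.conj_ofReal r
    rw [this]
    field_simp
    rw [hrr])
  -- Iwasawa decomposition: Gram–Schmidt on the columns of `g`, with `r` the norm of the first
  -- column and the unipotent parameter its inner product with the second, divided by `r ^ 2`.
  have hg : g = incl k * torus (Units.mk0 r hr0) *
      upper ((star α * g.1 0 1 + star γ * g.1 1 1) / r ^ 2) := by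
    apply Subtype.ext
    ext i j
    fin_cases i <;> fin_cases j <;>
      simp only [Fin.zero_eta, Fin.mk_one, Fin.isValue, ← hα, ← hγ] <;>
      simp [k, coe_incl_su2OfColumn, coe_upper, coe_torus, Matrix.SpecialLinearGroup.coe_mul] <;>
      simp only [RCLike.star_def] at hrr <;>
      field_simp
    · rw [hrr]
      linear_combination (- (starRingEnd ℂ) γ) * hdet
    · rw [hrr]
      linear_combination ((starRingEnd ℂ) α) * hdet
  rw [hg]
  exact S.mul_mem (S.mul_mem (hK _) (hT _)) (hU _)

/-- A subgroup that contains the diagonal matrices and is normalized by `SU(2)` contains the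
upper unipotent matrices. -/
theorem upper_mem_of_normalized {S : Subgroup SL2C} (hT : ∀ z, torus z ∈ S)
    (hK : ∀ (u : SU2) (g : SL2C), g ∈ S → incl u * g * (incl u)⁻¹ ∈ S) (t : ℂ) :
    upper t ∈ S := by
  -- The normalizer contains `SU(2)` by hypothesis and the torus because `S` does, so `S` is normal.
  have hN : Subgroup.normalizer (S : Set SL2C) = ⊤ := by
    refine eq_top_of_su2_of_torus (fun u => ?_) fun z => Subgroup.le_normalizer (hT z)
    rw [Subgroup.mem_normalizer_iff]
    refine fun g => ⟨hK u g, fun h => ?_⟩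
    have := hK u⁻¹ _ h
    rw [map_inv] at this
    simpa [mul_assoc] using this
  have h2 : (2 : ℂ) ≠ 0 := two_ne_zero
  refine upper_mem_of_ne_zero hT (w := 3) (by norm_num) ?_ t
  -- A commutator of a torus element with a unipotent; the parameter is `2 ^ 2 - 1`.
  have h4 : upper 3 = torus (Units.mk0 2 h2) * (upper 1 * (torus (Units.mk0 2 h2))⁻¹ * (upper 1)⁻¹) := by
    rw [← mul_assoc, ← mul_assoc, eq_mul_inv_iff_mul_eq, eq_mul_inv_iff_mul_eq, torus_mul_upper]
    congr 1
    apply Subtype.ext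
    ext i j
    fin_cases i <;> fin_cases j <;> simp [coe_upper, Matrix.SpecialLinearGroup.coe_mul]
    norm_num
  rw [h4]
  refine S.mul_mem (hT _) ?_
  have : upper 1 ∈ Subgroup.normalizer (S : Set SL2C) := by rw [hN]; trivial
  rw [Subgroup.mem_normalizer_iff] at this
  exact (this _).1 (S.inv_mem (hT _))

/-- The elements that are intertwined by a linear map form a subgroup. -/
def intertwinedSubgroup {G V W : Type*} [Group G] [AddCommMonoid V] [AddCommMonoid W] [Module ℂ V]
    [Module ℂ W] (ρ : Representation ℂ G V) (σ : Representation ℂ G W) (φ : V →ₗ[ℂ] W) :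
    Subgroup G where
  carrier := {g | φ ∘ₗ ρ g = σ g ∘ₗ φ}
  one_mem' := by simp [Module.End.one_eq_id]
  mul_mem' {g h} hg hh := by
    simp only [Set.mem_ofPred_eq, map_mul, Module.End.mul_eq_comp] at *
    rw [← LinearMap.comp_assoc, hg, LinearMap.comp_assoc, hh, LinearMap.comp_assoc]
  inv_mem' {g} hg := by
    simp only [Set.mem_ofPred_eq] at *
    ext x
    have h := LinearMap.congr_fun hg (ρ g⁻¹ x)
    simp only [LinearMap.comp_apply] at h
    rw [Representation.self_inv_apply] at h
    simp only [LinearMap.comp_apply]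
    rw [h, Representation.inv_self_apply]

theorem mem_intertwinedSubgroup {G V W : Type*} [Group G] [AddCommMonoid V] [AddCommMonoid W]
    [Module ℂ V] [Module ℂ W] {ρ : Representation ℂ G V} {σ : Representation ℂ G W}
    {φ : V →ₗ[ℂ] W} {g : G} : g ∈ intertwinedSubgroup ρ σ φ ↔ φ ∘ₗ ρ g = σ g ∘ₗ φ :=
  Iff.rfl

section Weights

variable {V W ι κ : Type*} [AddCommMonoid V] [AddCommMonoid W] [Module ℂ V] [Module ℂ W]
  (v : Module.Basis ι ℂ V) (w : Module.Basis κ ℂ W)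

/-- Applied to torus elements, this turns equivariance into conservation of weights;
`intertwines_of_eigenvalue_eq` goes back. Used together they extend equivariance from some torus
elements to others. -/
theorem eigenvalue_eq_of_repr_ne_zero {S : V →ₗ[ℂ] V} {T : W →ₗ[ℂ] W} {φ : V →ₗ[ℂ] W}
    (h : φ ∘ₗ S = T ∘ₗ φ) {χ : ι → ℂ} {ψ : κ → ℂ} (hS : ∀ i, S (v i) = χ i • v i)
    (hT : ∀ j, T (w j) = ψ j • w j) {i : ι} {j : κ} (hij : w.repr (φ (v i)) j ≠ 0) :
    χ i = ψ j := by
  have h1 : χ i • φ (v i) = T (φ (v i)) := by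
    rw [← map_smul, ← hS]
    exact LinearMap.congr_fun h _
  have h2 : ∀ x, w.repr (T x) j = ψ j * w.repr x j := by
    refine fun x => LinearMap.congr_fun (f := w.coord j ∘ₗ T) (g := ψ j • w.coord j) ?_ x
    apply w.ext
    intro k
    rcases eq_or_ne k j with rfl | hk
    · simp [hT]
    · simp [hT, Finsupp.single_eq_of_ne' hk]
  have h3 := congrArg (fun x => w.repr x j) h1
  simp only [map_smul, Finsupp.smul_apply, smul_eq_mul, h2] at h3
  exact mul_right_cancel₀ hij h3

theorem intertwines_of_eigenvalue_eq {S : V →ₗ[ℂ] V} {T : W →ₗ[ℂ] W} {φ : V →ₗ[ℂ] W}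
    {χ : ι → ℂ} {ψ : κ → ℂ} (hS : ∀ i, S (v i) = χ i • v i)
    (hT : ∀ j, T (w j) = ψ j • w j) (h : ∀ i j, w.repr (φ (v i)) j ≠ 0 → χ i = ψ j) :
    φ ∘ₗ S = T ∘ₗ φ := by
  apply v.ext
  intro i
  simp only [LinearMap.comp_apply, hS, map_smul]
  conv_rhs => rw [← w.linearCombination_repr (φ (v i))]
  conv_lhs => rw [← w.linearCombination_repr (φ (v i))]
  simp only [Finsupp.linearCombination_apply, Finsupp.sum, map_sum, map_smul, hT,
    Finset.smul_sum]
  refine Finset.sum_congr rfl fun j hj => ?_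
  rw [h i j (Finsupp.mem_support_iff.1 hj), smul_comm]

end Weights

/-! ### The canonical basis and Schur's lemma for a single spin -/

/-- The space of polynomials in two variables. -/
abbrev Poly : Type := MvPolynomial (Fin 2) ℂ

theorem spinBasis_apply (a : ℕ) (p : weights a) : spinBasis a p = spinVec a p := by
  simp [spinBasis]

/-- The normalization factor of the canonical vector. -/
def normalization (a : ℕ) (p : ℤ) : ℝ := √(a.choose ((a + p) / 2).toNat : ℝ)

theorem normalization_pos {a : ℕ} {p : ℤ} (hp : p ∈ weights a) : 0 < normalization a p := by
  rw [mem_weights] at hp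
  have h : 0 < a.choose ((a + p) / 2).toNat := Nat.choose_pos (by omega)
  exact Real.sqrt_pos.2 (by exact_mod_cast h)

theorem coe_spinBasis (a : ℕ) (p : weights a) :
    (spinBasis a p : Poly) = MvPolynomial.monomial (expo a p) (normalization a p : ℂ) := by
  rw [spinBasis_apply]
  rfl

theorem coeff_eq_normalization_mul_repr (a : ℕ) (f : Spin a) (p : weights a) :
    MvPolynomial.coeff (expo a p) (f : Poly) = normalization a p * (spinBasis a).repr f p := by
  refine LinearMap.congr_fun
    (f := MvPolynomial.lcoeff ℂ (expo a p) ∘ₗ (MvPolynomial.homogeneousSubmodule (Fin 2) ℂ a).subtype)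
    (g := (normalization a p : ℂ) • (spinBasis a).coord p) ?_ f
  apply (spinBasis a).ext
  intro q
  rcases eq_or_ne q p with rfl | h
  · simp [coe_spinBasis]
  · have : expo a q ≠ expo a p := fun h' => h (expo_injective a h')
    simp [coe_spinBasis, Finsupp.single_eq_of_ne' h, MvPolynomial.coeff_monomial, this]

theorem substitution_X (g : Matrix (Fin 2) (Fin 2) ℂ) (j : Fin 2) :
    substitution g (MvPolynomial.X j) = ∑ i, MvPolynomial.C (g i j) * MvPolynomial.X i := by
  simp [substitution]

theorem substitution_C (g : Matrix (Fin 2) (Fin 2) ℂ) (c : ℂ) :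
    substitution g (MvPolynomial.C c) = MvPolynomial.C c :=
  (substitution g).commutes c

theorem coe_spinRep (a : ℕ) (g : SL2C) (f : Spin a) :
    (spinRep a g f : Poly) = substitution g.1 f := rfl

theorem expo_two_mul_sub (a i : ℕ) (h : i ≤ a) :
    expo a (2 * (i : ℤ) - a) = Finsupp.single 0 i + Finsupp.single 1 (a - i) := by
  have h1 : ((a + (2 * (i : ℤ) - a)) / 2).toNat = i := by omega
  have h2 : ((a - (2 * (i : ℤ) - a)) / 2).toNat = a - i := by omega
  rw [expo, h1, h2]

theorem monomial_add_single (i j : ℕ) (c : ℂ) :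
    MvPolynomial.monomial (Finsupp.single (0 : Fin 2) i + Finsupp.single 1 j) c =
      MvPolynomial.C c * (MvPolynomial.X 0 ^ i * MvPolynomial.X 1 ^ j) := by
  rw [MvPolynomial.X_pow_eq_monomial, MvPolynomial.X_pow_eq_monomial, MvPolynomial.monomial_mul,
    MvPolynomial.C_mul_monomial]
  simp

theorem exists_eq_of_mem_weights {a : ℕ} {p : ℤ} (hp : p ∈ weights a) :
    ∃ i ≤ a, p = 2 * (i : ℤ) - a := by
  rw [mem_weights] at hp
  exact ⟨((p + a) / 2).toNat, by omega, by omega⟩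

theorem spinRep_torus (a : ℕ) (z : ℂˣ) (p : weights a) :
    spinRep a (torus z) (spinBasis a p) = (z : ℂ) ^ (p : ℤ) • spinBasis a p := by
  apply Subtype.ext
  rw [coe_spinRep, Submodule.coe_smul, coe_spinBasis]
  obtain ⟨i, hi, h⟩ := exists_eq_of_mem_weights p.2
  have hz := z.ne_zero
  rw [h, expo_two_mul_sub a i hi, monomial_add_single, map_mul, substitution_C, map_mul, map_pow,
    map_pow, substitution_X, substitution_X, MvPolynomial.smul_eq_C_mul]
  have : (z : ℂ) ^ (2 * (i : ℤ) - a) = (z : ℂ) ^ i * ((z : ℂ)⁻¹) ^ (a - i) := by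
    rw [← zpow_natCast, ← zpow_natCast, inv_zpow', ← zpow_add₀ hz]
    congr 1
    omega
  rw [this]
  simp only [coe_torus, Fin.sum_univ_two, map_mul, map_pow]
  simp [mul_pow]
  ring

/-- The matrix coefficients of the action of `upper 1` between neighbouring weights. -/
theorem repr_spinRep_upper_ne_zero (a : ℕ) (p q : weights a) (h : (q : ℤ) = p + 2) :
    (spinBasis a).repr (spinRep a (upper 1) (spinBasis a p)) q ≠ 0 := by
  intro h0
  have h1 := coeff_eq_normalization_mul_repr a (spinRep a (upper 1) (spinBasis a p)) q
  rw [h0, mul_zero, coe_spinRep, coe_spinBasis] at h1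
  obtain ⟨i, hi, hp⟩ := exists_eq_of_mem_weights p.2
  have hq : (q : ℤ) = 2 * ((i + 1 : ℕ) : ℤ) - a := by rw [h, hp]; push_cast; ring
  have hi' : i + 1 ≤ a := by
    have := mem_weights.1 q.2
    omega
  obtain ⟨j, rfl⟩ := Nat.exists_eq_add_of_le hi'
  rw [hp, hq, expo_two_mul_sub _ _ hi, expo_two_mul_sub _ _ hi', monomial_add_single, map_mul,
    substitution_C, map_mul, map_pow, map_pow, substitution_X, substitution_X,
    MvPolynomial.coeff_C_mul] at h1
  have hn := (normalization_pos p.2).ne'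
  rw [hp] at hn
  rcases mul_eq_zero.1 h1 with h2 | h2
  · exact hn (by exact_mod_cast h2)
  · have h3 : i + 1 + j - i = j + 1 := by omega
    have h4 : i + 1 + j - (i + 1) = j := by omega
    simp only [coe_upper, Fin.sum_univ_two, h3, h4] at h2
    have hmon : Finsupp.single (0 : Fin 2) (i + 1) + Finsupp.single (1 : Fin 2) j =
        Finsupp.single 0 i + (Finsupp.single 0 1 + Finsupp.single 1 j) := by
      rw [← add_assoc, ← Finsupp.single_add]
    rw [hmon] at h2
    simp only [Matrix.of_apply, Matrix.cons_val_zero, Matrix.cons_val_one, map_one, map_zero,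
      one_mul, zero_mul, add_zero] at h2
    rw [MvPolynomial.X_pow_eq_monomial (n := 0) (e := i)] at h2
    rw [MvPolynomial.coeff_monomial_mul, one_mul, add_pow] at h2
    -- After cancelling `X 0 ^ i`, what remains is a coefficient of `(X 0 + X 1) ^ (j + 1)`; only
    -- the term linear in `X 0` contributes, with value `j + 1`.
    rw [MvPolynomial.coeff_sum, Finset.sum_eq_single 1] at h2
    · have h5 : (MvPolynomial.X 0 ^ 1 * MvPolynomial.X 1 ^ (j + 1 - 1) * ((j + 1).choose 1 : Poly) : Poly)
          = MvPolynomial.monomial (Finsupp.single (0 : Fin 2) 1 + Finsupp.single 1 j) ((j : ℂ) + 1) := by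
        rw [monomial_add_single]
        simp
        ring
      rw [h5, MvPolynomial.coeff_monomial, if_pos rfl] at h2
      exact Nat.cast_add_one_ne_zero j h2
    · intro k _ hk
      have h5 : (MvPolynomial.X 0 ^ k * MvPolynomial.X 1 ^ (j + 1 - k) * ((j + 1).choose k : Poly) : Poly)
          = MvPolynomial.monomial (Finsupp.single (0 : Fin 2) k + Finsupp.single 1 (j + 1 - k))
            (((j + 1).choose k : ℕ) : ℂ) := by
        rw [monomial_add_single]
        simp
        ring
      rw [h5, MvPolynomial.coeff_monomial, if_neg]
      intro h6
      have := DFunLike.congr_fun h6 0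
      simp at this
      exact hk this
    · simp

/-- The matrices of `SL(2, ℂ)` in the canonical basis of the irrep of spin `a / 2`. -/
def wigner (a : ℕ) (g : SL2C) : Matrix (weights a) (weights a) ℂ :=
  LinearMap.toMatrix (spinBasis a) (spinBasis a) (spinRep a g)

theorem wigner_torus (a : ℕ) (z : ℂˣ) :
    wigner a (torus z) = Matrix.diagonal fun p : weights a => (z : ℂ) ^ (p : ℤ) := by
  ext p q
  rw [wigner, LinearMap.toMatrix_apply, spinRep_torus, map_smul, Module.Basis.repr_self]
  rcases eq_or_ne p q with rfl | h
  · simp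
  · simp [Matrix.diagonal_apply_ne _ h, Finsupp.single_eq_of_ne h]

theorem zpow_two_injective : Function.Injective fun n : ℤ => (2 : ℂ) ^ n := by
  intro m n h
  have h' : (((2 : ℝ) ^ m : ℝ) : ℂ) = (((2 : ℝ) ^ n : ℝ) : ℂ) := by push_cast; exact h
  exact zpow_right_injective₀ (by norm_num : (0 : ℝ) < 2) (by norm_num) (Complex.ofReal_injective h')

/-- One torus element is enough, since its eigenvalues `2 ^ p` separate the weights. -/
theorem eq_zero_of_wigner_comm {a b : ℕ} {M : Matrix (weights b) (weights a) ℂ}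
    (hT : M * wigner a (torus (Units.mk0 2 two_ne_zero)) =
      wigner b (torus (Units.mk0 2 two_ne_zero)) * M) {p : weights b} {q : weights a}
    (hpq : (p : ℤ) ≠ q) : M p q = 0 := by
  by_contra h
  have := congrFun (congrFun hT p) q
  rw [wigner_torus, wigner_torus, Matrix.mul_diagonal, Matrix.diagonal_mul, mul_comm] at this
  exact hpq (zpow_two_injective (mul_right_cancel₀ h this)).symm

/-- For a weight-preserving `M`, each side of an entry of the commutation relation reduces to one
term, linking two diagonal entries of `M`. -/
theorem wigner_upper_comm {a b : ℕ} {M : Matrix (weights b) (weights a) ℂ}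
    (hT : ∀ (p : weights b) (q : weights a), (p : ℤ) ≠ q → M p q = 0)
    (hU : M * wigner a (upper 1) = wigner b (upper 1) * M)
    (p : weights b) (q : weights a) (hp : (p : ℤ) ∈ weights a) (hq : (q : ℤ) ∈ weights b) :
    M p ⟨p, hp⟩ * wigner a (upper 1) ⟨p, hp⟩ q = wigner b (upper 1) p ⟨q, hq⟩ * M ⟨q, hq⟩ q := by
  have := congrFun (congrFun hU p) q
  rwa [Matrix.mul_apply, Matrix.mul_apply, Finset.sum_eq_single ⟨p, hp⟩,
    Finset.sum_eq_single ⟨q, hq⟩] at this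
  · intro r _ hr
    rw [hT, mul_zero]
    intro h
    exact hr (Subtype.ext h)
  · simp
  · intro r _ hr
    rw [hT, zero_mul]
    intro h
    exact hr (Subtype.ext h.symm)
  · simp

/-- The common weights form a chain of step two, and `upper 1` has nonzero entries between
neighbours, so a zero of `M` on the diagonal propagates along the whole chain. -/
theorem eq_zero_of_wigner_comm_of_exists {a b : ℕ} {M : Matrix (weights b) (weights a) ℂ}
    (hT : ∀ (p : weights b) (q : weights a), (p : ℤ) ≠ q → M p q = 0)
    (hU : M * wigner a (upper 1) = wigner b (upper 1) * M)
    {p₀ : weights b} {q₀ : weights a} (h₀ : (p₀ : ℤ) = q₀) (hM : M p₀ q₀ = 0) : M = 0 := by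
  have up : ∀ (n : ℤ) (ha : n ∈ weights a) (hb : n ∈ weights b) (ha' : n + 2 ∈ weights a)
      (hb' : n + 2 ∈ weights b), M ⟨n, hb⟩ ⟨n, ha⟩ = 0 ↔ M ⟨n + 2, hb'⟩ ⟨n + 2, ha'⟩ = 0 := by
    intro n ha hb ha' hb'
    have h := wigner_upper_comm hT hU ⟨n + 2, hb'⟩ ⟨n, ha⟩ ha' hb
    have h1 : wigner a (upper 1) ⟨n + 2, ha'⟩ ⟨n, ha⟩ ≠ 0 := by
      rw [wigner, LinearMap.toMatrix_apply]
      exact repr_spinRep_upper_ne_zero a _ _ rfl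
    have h2 : wigner b (upper 1) ⟨n + 2, hb'⟩ ⟨n, hb⟩ ≠ 0 := by
      rw [wigner, LinearMap.toMatrix_apply]
      exact repr_spinRep_upper_ne_zero b _ _ rfl
    constructor
    · intro h3
      rw [h3, mul_zero] at h
      exact (mul_eq_zero.1 h).resolve_right h1
    · intro h3
      rw [h3, zero_mul] at h
      exact (mul_eq_zero.1 h.symm).resolve_left h2
  have step : ∀ (k : ℕ) (n : ℤ) (ha : n ∈ weights a) (hb : n ∈ weights b)
      (ha' : n + 2 * k ∈ weights a) (hb' : n + 2 * k ∈ weights b),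
      M ⟨n, hb⟩ ⟨n, ha⟩ = 0 ↔ M ⟨n + 2 * k, hb'⟩ ⟨n + 2 * k, ha'⟩ = 0 := by
    intro k
    induction k with
    | zero => intro n ha hb ha' hb'; simp
    | succ k ih =>
      intro n ha hb ha' hb'
      have ha1 : n + 2 * k ∈ weights a := by rw [mem_weights] at *; omega
      have hb1 : n + 2 * k ∈ weights b := by rw [mem_weights] at *; omega
      have e : n + 2 * ((k + 1 : ℕ) : ℤ) = n + 2 * k + 2 := by push_cast; ring
      rw [ih n ha hb ha1 hb1, up _ ha1 hb1 (by rwa [← e]) (by rwa [← e])]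
      simp only [e]
  ext p q
  by_cases hpq : (p : ℤ) = q
  · obtain ⟨p, hp⟩ := p
    obtain ⟨q, hq⟩ := q
    obtain ⟨p₀, hp₀⟩ := p₀
    obtain ⟨q₀, hq₀⟩ := q₀
    simp only at hpq h₀
    subst hpq h₀
    have hh1 := mem_weights.1 hp
    have hh2 := mem_weights.1 hp₀
    rcases le_total p p₀ with h | h
    · obtain ⟨k, hk⟩ : ∃ k : ℕ, p₀ = p + 2 * k := ⟨((p₀ - p) / 2).toNat, by omega⟩
      subst hk
      exact (step k p hq hp hq₀ hp₀).2 hM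
    · obtain ⟨k, hk⟩ : ∃ k : ℕ, p = p₀ + 2 * k := ⟨((p - p₀) / 2).toNat, by omega⟩
      subst hk
      exact (step k p₀ hq₀ hp₀ hq hp).1 hM
  · exact hT p q hpq

/-- Schur's lemma for the irreps of `SL(2, ℂ)`, in terms of matrices. -/
theorem exists_scalar_of_wigner_comm {a b : ℕ} {M : Matrix (weights b) (weights a) ℂ}
    (hT : M * wigner a (torus (Units.mk0 2 two_ne_zero)) =
      wigner b (torus (Units.mk0 2 two_ne_zero)) * M)
    (hU : M * wigner a (upper 1) = wigner b (upper 1) * M) :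
    ∃ c : ℂ, (a ≠ b → c = 0) ∧ ∀ p q, M p q = if (p : ℤ) = q then c else 0 := by
  have hT' : ∀ (p : weights b) (q : weights a), (p : ℤ) ≠ q → M p q = 0 :=
    fun p q h => eq_zero_of_wigner_comm hT h
  by_cases hab : a = b
  · subst hab
    have ha : (a : ℤ) ∈ weights a := mem_weights.2 (by omega)
    refine ⟨M ⟨a, ha⟩ ⟨a, ha⟩, fun h => absurd rfl h, ?_⟩
    -- Subtracting the scalar read off at the highest weight leaves a commuting matrix that vanishes
    -- there.
    have h := eq_zero_of_wigner_comm_of_exists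
      (M := M - M ⟨a, ha⟩ ⟨a, ha⟩ • (1 : Matrix (weights a) (weights a) ℂ)) ?_ ?_
      (p₀ := ⟨a, ha⟩) (q₀ := ⟨a, ha⟩) rfl (by simp)
    · intro p q
      have h' := congrFun (congrFun (sub_eq_zero.1 h) p) q
      rw [Matrix.smul_apply, Matrix.one_apply] at h'
      simpa only [Subtype.ext_iff, smul_eq_mul, mul_ite, mul_one, mul_zero] using h'
    · intro p q hpq
      have : p ≠ q := fun h => hpq (congrArg _ h)
      simp [hT' p q hpq, Matrix.one_apply_ne this]
    · rw [Matrix.sub_mul, Matrix.mul_sub, hU]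
      simp
  · refine ⟨0, fun _ => rfl, ?_⟩
    suffices h : M = 0 by simp [h]
    by_cases hpar : (a + b) % 2 = 0
    · rcases lt_or_gt_of_ne hab with h | h
      · have ha : (a : ℤ) ∈ weights a := mem_weights.2 (by omega)
        have hb : (a : ℤ) ∈ weights b := mem_weights.2 (by omega)
        have hb' : (a : ℤ) + 2 ∈ weights b := mem_weights.2 (by omega)
        -- At the top weight of the smaller spin: row `a + 2` of `M` vanishes, but `upper 1` reaches
        -- `a + 2` from `a` in spin `b / 2`.
        refine eq_zero_of_wigner_comm_of_exists hT' hU (p₀ := ⟨a, hb⟩) (q₀ := ⟨a, ha⟩) rfl ?_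
        have h1 := congrFun (congrFun hU ⟨(a : ℤ) + 2, hb'⟩) ⟨a, ha⟩
        rw [Matrix.mul_apply, Matrix.mul_apply, Finset.sum_eq_zero,
          Finset.sum_eq_single ⟨a, hb⟩] at h1
        · refine (mul_eq_zero.1 h1.symm).resolve_left ?_
          rw [wigner, LinearMap.toMatrix_apply]
          exact repr_spinRep_upper_ne_zero b _ _ rfl
        · intro r _ hr
          rw [hT', mul_zero]
          intro h
          exact hr (Subtype.ext h)
        · simp
        · intro r _
          rw [hT', zero_mul]
          have := mem_weights.1 r.2
          simp only
          omega
      · have ha : -(b : ℤ) ∈ weights a := mem_weights.2 (by omega)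
        have hb : -(b : ℤ) ∈ weights b := mem_weights.2 (by omega)
        have ha' : -(b : ℤ) - 2 ∈ weights a := mem_weights.2 (by omega)
        -- Since `upper 1` only raises weights, the other case uses the lowest weight: column `-b -
        -- 2` of `M` vanishes.
        refine eq_zero_of_wigner_comm_of_exists hT' hU (p₀ := ⟨-b, hb⟩) (q₀ := ⟨-b, ha⟩) rfl ?_
        have h1 := congrFun (congrFun hU ⟨-(b : ℤ), hb⟩) ⟨-(b : ℤ) - 2, ha'⟩
        rw [Matrix.mul_apply, Matrix.mul_apply, Finset.sum_eq_single ⟨-b, ha⟩,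
          Finset.sum_eq_zero] at h1
        · refine (mul_eq_zero.1 h1).resolve_right ?_
          rw [wigner, LinearMap.toMatrix_apply]
          exact repr_spinRep_upper_ne_zero a _ _ (by simp)
        · intro r _
          rw [hT', mul_zero]
          have := mem_weights.1 r.2
          simp only
          omega
        · intro r _ hr
          rw [hT', zero_mul]
          intro h
          exact hr (Subtype.ext h.symm)
        · simp
    · ext p q
      refine hT' p q ?_
      have := mem_weights.1 p.2
      have := mem_weights.1 q.2
      omega

/-! ### The pairing of binary forms and transposition -/

theorem pderiv_substitution (g : Matrix (Fin 2) (Fin 2) ℂ) (i : Fin 2) (f : Poly) :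
    MvPolynomial.pderiv i (substitution g f) =
      ∑ j, g i j • substitution g (MvPolynomial.pderiv j f) := by
  induction f using MvPolynomial.induction_on with
  | C c => simp
  | add f h hf hh => simp [hf, hh, Finset.sum_add_distrib, smul_add, map_add]
  | mul_X f j hf =>
    rw [map_mul, MvPolynomial.pderiv_mul, hf, substitution_X]
    fin_cases i <;> fin_cases j <;>
      simp [Fin.sum_univ_two, substitution_X,
        MvPolynomial.smul_eq_C_mul, MvPolynomial.pderiv_X] <;> ring

section Pairing

open scoped Nat

/-- The symmetric bilinear form on polynomials with `⟨X ^ d, X ^ e⟩ = d!` if `d = e`, and zero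
otherwise. -/
def pairing : Poly →ₗ[ℂ] Poly →ₗ[ℂ] ℂ :=
  (MvPolynomial.basisMonomials (Fin 2) ℂ).constr ℂ fun d =>
    (((d 0)! : ℂ) * ((d 1)! : ℂ)) • MvPolynomial.lcoeff ℂ d

theorem pairing_monomial (d : Fin 2 →₀ ℕ) (c : ℂ) (h : Poly) :
    pairing (MvPolynomial.monomial d c) h =
      c * ((((d 0)! : ℂ) * ((d 1)! : ℂ)) * MvPolynomial.coeff d h) := by
  have h1 : MvPolynomial.monomial d c = c • MvPolynomial.basisMonomials (Fin 2) ℂ d := by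
    simp [MvPolynomial.smul_monomial]
  rw [h1, map_smul, pairing, Module.Basis.constr_basis]
  simp

/-- Raising one exponent multiplies its factorial by exactly the factor that differentiation
produces. -/
theorem pairing_X_mul (i : Fin 2) (f h : Poly) :
    pairing (MvPolynomial.X i * f) h = pairing f (MvPolynomial.pderiv i h) := by
  induction f using MvPolynomial.induction_on' with
  | monomial d c =>
    rw [mul_comm, MvPolynomial.X, MvPolynomial.monomial_mul, mul_one, pairing_monomial,
      pairing_monomial, MvPolynomial.coeff_pderiv]
    fin_cases i <;> simp [Nat.factorial_succ, -mul_eq_mul_left_iff] <;> ring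
  | add f f' hf hf' => simp [mul_add, hf, hf']

theorem pairing_comm (f h : Poly) : pairing f h = pairing h f := by
  induction f using MvPolynomial.induction_on' with
  | monomial d c =>
    induction h using MvPolynomial.induction_on' with
    | monomial e c' =>
      rw [pairing_monomial, pairing_monomial, MvPolynomial.coeff_monomial,
        MvPolynomial.coeff_monomial]
      rcases eq_or_ne d e with rfl | hde
      · simp; ring
      · simp [hde, hde.symm]
    | add f f' hf hf' => simp [hf, hf']
  | add f f' hf hf' => simp [hf, hf']

theorem coeff_zero_substitution (g : Matrix (Fin 2) (Fin 2) ℂ) (f : Poly) :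
    MvPolynomial.coeff 0 (substitution g f) = MvPolynomial.coeff 0 f := by
  induction f using MvPolynomial.induction_on with
  | C c => simp
  | add f h hf hh => simp [hf, hh]
  | mul_X f j hf =>
    simp only [← MvPolynomial.constantCoeff_eq, map_mul, substitution_X, map_sum]
    simp

/-- By induction over multiplication by variables: the adjoint of such a multiplication is a
derivative, and moving it through the substitution by the chain rule transposes `g`. -/
theorem pairing_substitution (g : Matrix (Fin 2) (Fin 2) ℂ) (f h : Poly) :
    pairing (substitution g f) h = pairing f (substitution gᵀ h) := by
  induction f using MvPolynomial.induction_on generalizing h with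
  | C c =>
    rw [substitution_C, MvPolynomial.C_apply, pairing_monomial, pairing_monomial,
      coeff_zero_substitution]
  | add f f' hf hf' => simp [hf, hf']
  | mul_X f j hf =>
    rw [map_mul, mul_comm, substitution_X, Finset.sum_mul, mul_comm, pairing_X_mul,
      pderiv_substitution, map_sum, map_sum, LinearMap.sum_apply]
    refine Finset.sum_congr rfl fun i _ => ?_
    rw [mul_assoc, ← MvPolynomial.smul_eq_C_mul, map_smul, LinearMap.smul_apply, pairing_X_mul, hf,
      map_smul, Matrix.transpose_apply]

/-- The square-root binomials in the canonical basis are chosen so that all its vectors have the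
same square `a !`, by `choose * i ! * (a - i)! = a !`. -/
theorem pairing_spinBasis (a : ℕ) (p : weights a) (f : Spin a) :
    pairing (spinBasis a p : Poly) f = a ! * (spinBasis a).repr f p := by
  rw [coe_spinBasis, pairing_monomial, coeff_eq_normalization_mul_repr]
  obtain ⟨i, hi, hp⟩ := exists_eq_of_mem_weights p.2
  have h1 : (normalization a p : ℂ) * normalization a p = (a.choose i : ℂ) := by
    rw [← Complex.ofReal_mul, normalization, Real.mul_self_sqrt (Nat.cast_nonneg _),
      Complex.ofReal_natCast, hp]
    congr 3
    omega
  rw [hp] at h1 ⊢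
  rw [expo_two_mul_sub a i hi]
  have h2 : ((a.choose i * i ! * (a - i)! : ℕ) : ℂ) = a ! := by
    rw [Nat.choose_mul_factorial_mul_factorial hi]
  push_cast at h2
  simp only [Finsupp.add_apply, Finsupp.single_eq_same, ne_eq, Fin.isValue, one_ne_zero, zero_ne_one,
    not_false_eq_true, Finsupp.single_eq_of_ne, add_zero, zero_add]
  rw [← h2, ← h1]
  ring

/-- In the canonical basis, transposition of the group element is transposition of its matrix. -/
theorem wigner_transpose (a : ℕ) (g : SL2C) : wigner a g.transpose = (wigner a g)ᵀ := by
  ext p q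
  have h : (a ! : ℂ) ≠ 0 := by exact_mod_cast a.factorial_ne_zero
  apply mul_left_cancel₀ h
  rw [Matrix.transpose_apply, wigner, wigner, LinearMap.toMatrix_apply, LinearMap.toMatrix_apply,
    ← pairing_spinBasis, ← pairing_spinBasis, coe_spinRep, coe_spinRep,
    pairing_comm (spinBasis a q : Poly), pairing_substitution]
  rfl

end Pairing

/-! ### Transvectants -/

/-- The partial derivative of binary forms. -/
def spinDeriv (a : ℕ) (i : Fin 2) : Spin (a + 1) →ₗ[ℂ] Spin a :=
  (MvPolynomial.pderiv i).toLinearMap.restrict fun f hf => by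
    rw [MvPolynomial.mem_homogeneousSubmodule] at hf ⊢
    exact hf.pderiv

theorem coe_spinDeriv (a : ℕ) (i : Fin 2) (f : Spin (a + 1)) :
    (spinDeriv a i f : Poly) = MvPolynomial.pderiv i (f : Poly) := rfl

theorem spinDeriv_spinRep (a : ℕ) (i : Fin 2) (g : SL2C) (f : Spin (a + 1)) :
    spinDeriv a i (spinRep (a + 1) g f) = ∑ j, g.1 i j • spinRep a g (spinDeriv a j f) := by
  apply Subtype.ext
  simp only [Submodule.coe_sum, Submodule.coe_smul, coe_spinDeriv, coe_spinRep, pderiv_substitution]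

/-- The multiplication of binary forms. -/
def spinMul (a b : ℕ) : Spin a ⊗[ℂ] Spin b →ₗ[ℂ] Spin (a + b) :=
  TensorProduct.lift (LinearMap.mk₂ ℂ
    (fun f h => (⟨f.1 * h.1, by
      have hf := f.2
      have hh := h.2
      rw [MvPolynomial.mem_homogeneousSubmodule] at hf hh ⊢
      exact hf.mul hh⟩ : Spin (a + b)))
    (fun _ _ _ => Subtype.ext (add_mul _ _ _)) (fun _ _ _ => Subtype.ext (smul_mul_assoc _ _ _))
    (fun _ _ _ => Subtype.ext (mul_add _ _ _)) (fun _ _ _ => Subtype.ext (mul_smul_comm _ _ _)))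

/-- The differential operator `∂₀ ⊗ ∂₁ - ∂₁ ⊗ ∂₀`. -/
def omega (a b : ℕ) : Spin (a + 1) ⊗[ℂ] Spin (b + 1) →ₗ[ℂ] Spin a ⊗[ℂ] Spin b :=
  TensorProduct.map (spinDeriv a 0) (spinDeriv b 1) +
    (-1 : ℂ) • TensorProduct.map (spinDeriv a 1) (spinDeriv b 0)

theorem omega_tmul (a b : ℕ) (f : Spin (a + 1)) (h : Spin (b + 1)) :
    omega a b (f ⊗ₜ h) = spinDeriv a 0 f ⊗ₜ spinDeriv b 1 h +
      (-1 : ℂ) • (spinDeriv a 1 f ⊗ₜ spinDeriv b 0 h) := rfl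

/-- Gradients transform by `g`, so their antisymmetric combination acquires the factor `det g = 1`.
-/
theorem omega_spinRep (a b : ℕ) (g : SL2C) (f : Spin (a + 1)) (h : Spin (b + 1)) :
    omega a b (spinRep (a + 1) g f ⊗ₜ spinRep (b + 1) g h) =
      TensorProduct.map (spinRep a g) (spinRep b g) (omega a b (f ⊗ₜ h)) := by
  have hdet := g.2
  rw [Matrix.det_fin_two] at hdet
  rw [omega_tmul, omega_tmul, spinDeriv_spinRep, spinDeriv_spinRep, spinDeriv_spinRep,
    spinDeriv_spinRep]
  simp only [Fin.sum_univ_two, TensorProduct.add_tmul, TensorProduct.tmul_add,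
    ← TensorProduct.smul_tmul', TensorProduct.tmul_smul, map_add, map_smul, TensorProduct.map_tmul]
  generalize spinRep a g (spinDeriv a 0 f) ⊗ₜ[ℂ] spinRep b g (spinDeriv b 1 h) = x
  generalize spinRep a g (spinDeriv a 1 f) ⊗ₜ[ℂ] spinRep b g (spinDeriv b 0 h) = y
  have : x + (-1 : ℂ) • y =
      (g.1 0 0 * g.1 1 1 - g.1 0 1 * g.1 1 0) • (x + (-1 : ℂ) • y) := by rw [hdet, one_smul]
  rw [this]
  module

/-- The transvectants: powers of `∂₀ ⊗ ∂₁ - ∂₁ ⊗ ∂₀` followed by multiplication. -/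
theorem exists_transvectant (a b j : ℕ) : ∀ A B : ℕ, A = a + j → B = b + j →
    ∃ Ψ : Spin A ⊗[ℂ] Spin B →ₗ[ℂ] Spin (a + b),
      (∀ g f h, Ψ (spinRep A g f ⊗ₜ spinRep B g h) = spinRep (a + b) g (Ψ (f ⊗ₜ h))) ∧
      (∀ (f : Spin A) (h : Spin B), MvPolynomial.map (starRingEnd ℂ) (f : Poly) = f →
        MvPolynomial.map (starRingEnd ℂ) (h : Poly) = h →
        MvPolynomial.map (starRingEnd ℂ) (Ψ (f ⊗ₜ h) : Poly) = Ψ (f ⊗ₜ h)) ∧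
      ∀ (f : Spin A) (h : Spin B) (c c' : ℂ), c ≠ 0 → c' ≠ 0 →
        (f : Poly) = MvPolynomial.C c * MvPolynomial.X 0 ^ A →
        (h : Poly) = MvPolynomial.C c' * MvPolynomial.X 1 ^ B → Ψ (f ⊗ₜ h) ≠ 0 := by
  induction j with
  | zero =>
    rintro A B rfl rfl
    refine ⟨spinMul _ _, fun g f h => ?_, fun f h hf hh => ?_,
      fun f h c c' hc hc' hf hh h0 => ?_⟩
    · apply Subtype.ext
      exact (map_mul (substitution g.1) _ _).symm
    · change MvPolynomial.map (starRingEnd ℂ) ((f : Poly) * (h : Poly)) = f * h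
      rw [map_mul, hf, hh]
    · have : (f : Poly) * (h : Poly) = 0 := congrArg Subtype.val h0
      rw [hf, hh] at this
      simp [hc, hc'] at this
  | succ j ih =>
    intro A B hA hB
    obtain ⟨Ψ, h1, h2, h3⟩ := ih (a + j) (b + j) rfl rfl
    -- Keeping the degrees as variables with equations lets `omega` apply after substitution, with
    -- no transport between `Spin` types.
    rw [← Nat.add_assoc] at hA hB
    subst hA hB
    refine ⟨Ψ ∘ₗ omega (a + j) (b + j), fun g f h => ?_, fun f h hf hh => ?_,
      fun f h c c' hc hc' hf hh => ?_⟩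
    · rw [LinearMap.comp_apply, LinearMap.comp_apply, omega_spinRep, omega_tmul]
      simp only [map_add, map_smul, TensorProduct.map_tmul, h1]
    · rw [LinearMap.comp_apply, omega_tmul, map_add, map_smul, Submodule.coe_add,
        Submodule.coe_smul, map_add, MvPolynomial.smul_eq_C_mul, map_mul, h2, h2]
      · simp
      all_goals
        rw [coe_spinDeriv, ← MvPolynomial.pderiv_map]
        first | rw [hf] | rw [hh]
    · have h4 : spinDeriv (a + j) 1 f = 0 := by
        apply Subtype.ext
        rw [coe_spinDeriv, hf]
        simp
      rw [LinearMap.comp_apply, omega_tmul, h4, TensorProduct.zero_tmul, smul_zero, add_zero]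
      refine h3 _ _ (c * (a + j + 1)) (c' * (b + j + 1))
        (mul_ne_zero hc (by exact_mod_cast (a + j).succ_ne_zero))
        (mul_ne_zero hc' (by exact_mod_cast (b + j).succ_ne_zero)) ?_ ?_
      · rw [coe_spinDeriv, hf]
        simp
        ring
      · rw [coe_spinDeriv, hh]
        simp
        ring

theorem map_conj_spinBasis (a : ℕ) (p : weights a) :
    MvPolynomial.map (starRingEnd ℂ) (spinBasis a p : Poly) = spinBasis a p := by
  rw [coe_spinBasis, MvPolynomial.map_monomial, Complex.conj_ofReal]

theorem repr_im_eq_zero {a : ℕ} {f : Spin a}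
    (hf : MvPolynomial.map (starRingEnd ℂ) (f : Poly) = f) (p : weights a) :
    ((spinBasis a).repr f p).im = 0 := by
  have h := coeff_eq_normalization_mul_repr a f p
  have h1 : ((normalization a p * (spinBasis a).repr f p : ℂ)).im = 0 := by
    rw [← h, ← Complex.conj_eq_iff_im, ← MvPolynomial.coeff_map, hf]
  rw [Complex.im_ofReal_mul] at h1
  exact (mul_eq_zero.1 h1).resolve_left (normalization_pos p.2).ne'

theorem exists_real_intertwiner {a b c : ℕ} (hc : c ∈ spins a b) :
    ∃ Ψ : Spin a ⊗[ℂ] Spin b →ₗ[ℂ] Spin c, Ψ ≠ 0 ∧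
      (∀ g, Ψ ∘ₗ ((spinRep a).tprod (spinRep b)) g = spinRep c g ∘ₗ Ψ) ∧
      ∀ i r, ((spinBasis c).repr (Ψ (prodBasis a b i)) r).im = 0 := by
  obtain ⟨a', b', j, rfl, rfl, rfl⟩ : ∃ a' b' j, a = a' + j ∧ b = b' + j ∧ c = a' + b' := by
    rw [mem_spins] at hc
    -- The order of the transvectant: each application of `omega` lowers the total degree by two.
    exact ⟨a - (a + b - c) / 2, b - (a + b - c) / 2, (a + b - c) / 2, by omega, by omega, by omega⟩
  obtain ⟨Ψ, h1, h2, h3⟩ := exists_transvectant a' b' j _ _ rfl rfl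
  refine ⟨Ψ, fun h0 => ?_, fun g => TensorProduct.ext' fun f h => h1 g f h, fun i r => ?_⟩
  · refine h3 ⟨MvPolynomial.X 0 ^ (a' + j), ?_⟩ ⟨MvPolynomial.X 1 ^ (b' + j), ?_⟩ 1 1 one_ne_zero
      one_ne_zero (by simp) (by simp) (by rw [h0]; rfl)
    · rw [MvPolynomial.mem_homogeneousSubmodule]
      simpa using (MvPolynomial.isHomogeneous_X ℂ (0 : Fin 2)).pow (a' + j)
    · rw [MvPolynomial.mem_homogeneousSubmodule]
      simpa using (MvPolynomial.isHomogeneous_X ℂ (1 : Fin 2)).pow (b' + j)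
  · rw [prodBasis, Module.Basis.tensorProduct_apply']
    exact repr_im_eq_zero (h2 _ _ (map_conj_spinBasis _ _) (map_conj_spinBasis _ _)) r

section DirectSumBasis

variable {ι : Type} {V : ι → Type} [∀ i, AddCommMonoid (V i)] [∀ i, Module ℂ (V i)]
  {η : ι → Type}

theorem dfinsuppBasis_apply [DecidableEq ι] (b : ∀ i, Module.Basis (η i) ℂ (V i)) (j : Σ i, η i) :
    (DFinsupp.basis b j : ⨁ i, V i) = DirectSum.lof ℂ ι V j.1 (b j.1 j.2) := by
  classical
  apply (DFinsupp.basis b).repr.injective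
  ext k
  rw [Module.Basis.repr_self]
  change _ = (b k.1).repr (DirectSum.lof ℂ ι V j.1 (b j.1 j.2) k.1) k.2
  obtain ⟨i, x⟩ := j
  obtain ⟨k, y⟩ := k
  rcases eq_or_ne i k with rfl | h
  · rw [DirectSum.lof_apply, Module.Basis.repr_self]
    rcases eq_or_ne x y with rfl | hxy
    · simp
    · rw [Finsupp.single_eq_of_ne' hxy, Finsupp.single_eq_of_ne']
      simpa using hxy
  · rw [DirectSum.lof_eq_of, DirectSum.of_eq_of_ne _ _ _ h.symm, map_zero, Finsupp.single_eq_of_ne']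
    · rfl
    · simp [h]

end DirectSumBasis

/-! ### Existence of orthogonal Clebsch–Gordan maps of `SU(2)` -/

theorem sumBasis_apply (a b : ℕ) (j : Σ c : spins a b, weights c) :
    sumBasis a b j = DirectSum.lof ℂ (spins a b) (fun c => Spin c) j.1 (spinBasis j.1 j.2) :=
  dfinsuppBasis_apply _ _

theorem prodBasis_apply (a b : ℕ) (i : weights a × weights b) :
    prodBasis a b i = spinBasis a i.1 ⊗ₜ spinBasis b i.2 :=
  Module.Basis.tensorProduct_apply' _ _ _

/-- The matrices of `SL(2, ℂ)` in the basis of products of canonical vectors. -/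
def prodWigner (a b : ℕ) (g : SL2C) : Matrix (weights a × weights b) (weights a × weights b) ℂ :=
  wigner a g ⊗ₖ wigner b g

theorem toMatrix_tprod_spinRep (a b : ℕ) (g : SL2C) :
    LinearMap.toMatrix (prodBasis a b) (prodBasis a b) ((spinRep a).tprod (spinRep b) g) =
      prodWigner a b g :=
  TensorProduct.toMatrix_map _ _ _ _ _ _

theorem prodWigner_transpose (a b : ℕ) (g : SL2C) :
    prodWigner a b g.transpose = (prodWigner a b g)ᵀ := by
  rw [prodWigner, wigner_transpose, wigner_transpose, prodWigner, Matrix.kroneckerMap_transpose]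

/-- Transpose the relation at `g.transpose`; the matrices of both representations turn back into
those of `g`. -/
theorem transpose_comm_of_comm {a b c : ℕ} {M : Matrix (weights a × weights b) (weights c) ℂ}
    (h : ∀ g, prodWigner a b g * M = M * wigner c g) (g : SL2C) :
    Mᵀ * prodWigner a b g = wigner c g * Mᵀ := by
  have := congrArg Matrix.transpose (h g.transpose)
  rw [prodWigner_transpose, wigner_transpose, Matrix.transpose_mul, Matrix.transpose_mul,
    Matrix.transpose_transpose, Matrix.transpose_transpose] at this
  exact this

theorem exists_scalar_transpose_mul {a b c d : ℕ}
    {M : Matrix (weights a × weights b) (weights c) ℂ}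
    {N : Matrix (weights a × weights b) (weights d) ℂ}
    (hM : ∀ g, prodWigner a b g * M = M * wigner c g)
    (hN : ∀ g, prodWigner a b g * N = N * wigner d g) :
    ∃ s : ℂ, (d ≠ c → s = 0) ∧ ∀ p q, (Mᵀ * N) p q = if (p : ℤ) = q then s else 0 := by
  have h : ∀ g, Mᵀ * N * wigner d g = wigner c g * (Mᵀ * N) := fun g => by
    rw [Matrix.mul_assoc, ← hN, ← Matrix.mul_assoc, transpose_comm_of_comm hM, Matrix.mul_assoc]
  exact exists_scalar_of_wigner_comm (h _) (h _)

/-- For a real intertwiner `N`, Schur makes `N * Nᵀ` a scalar. Reality makes that scalar a sum of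
squares, positive since `N` is nonzero, so dividing by its root gives an isometry. -/
theorem exists_isometric_intertwiner {a b c : ℕ} (hc : c ∈ spins a b) :
    ∃ M : Matrix (weights a × weights b) (weights c) ℂ, (∀ i r, (M i r).im = 0) ∧ Mᵀ * M = 1 ∧
      ∀ g, prodWigner a b g * M = M * wigner c g := by
  obtain ⟨Ψ, h0, hΨ, hreal⟩ := exists_real_intertwiner hc
  set N := LinearMap.toMatrix (prodBasis a b) (spinBasis c) Ψ with hN
  have hNreal : ∀ r i, (N r i).im = 0 := fun r i => by
    rw [hN, LinearMap.toMatrix_apply]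
    exact hreal i r
  have hcomm : ∀ g, N * prodWigner a b g = wigner c g * N := fun g => by
    rw [← toMatrix_tprod_spinRep, hN, wigner, ← LinearMap.toMatrix_comp, ← LinearMap.toMatrix_comp,
      hΨ]
  have hcomm' : ∀ g, prodWigner a b g * Nᵀ = Nᵀ * wigner c g := fun g => by
    have := congrArg Matrix.transpose (hcomm g.transpose)
    rw [prodWigner_transpose, wigner_transpose, Matrix.transpose_mul, Matrix.transpose_mul,
      Matrix.transpose_transpose, Matrix.transpose_transpose] at this
    exact this
  obtain ⟨s, -, hs⟩ := exists_scalar_transpose_mul hcomm' hcomm'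
  rw [Matrix.transpose_transpose] at hs
  have hNre : ∀ r i, N r i = ((N r i).re : ℂ) := fun r i =>
    Complex.ext rfl (by simp [hNreal r i])
  have hdiag : ∀ r, s = ((∑ i, (N r i).re ^ 2 : ℝ) : ℂ) := fun r => by
    have := hs r r
    rw [if_pos rfl, Matrix.mul_apply] at this
    rw [← this]
    push_cast
    refine Finset.sum_congr rfl fun i _ => ?_
    rw [Matrix.transpose_apply, pow_two, ← hNre]
  obtain ⟨r, i, hri⟩ : ∃ r i, N r i ≠ 0 := by
    by_contra! h
    apply h0
    have : N = 0 := by ext r i; exact h r i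
    rwa [hN, LinearEquiv.map_eq_zero_iff] at this
  have hpos : 0 < ∑ i, (N r i).re ^ 2 := by
    refine Finset.sum_pos' (fun _ _ => sq_nonneg _) ⟨i, Finset.mem_univ _, ?_⟩
    refine sq_pos_of_ne_zero fun h => hri ?_
    rw [hNre, h, Complex.ofReal_zero]
  set t := √(∑ i, (N r i).re ^ 2) with ht
  have ht0 : (t : ℂ) ≠ 0 := by exact_mod_cast (Real.sqrt_pos.2 hpos).ne'
  have hst : s = (t : ℂ) * t := by
    rw [hdiag r, ← Complex.ofReal_mul, ht, Real.mul_self_sqrt hpos.le]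
  refine ⟨((t⁻¹ : ℝ) : ℂ) • Nᵀ, fun i r => ?_, ?_, fun g => ?_⟩
  · rw [Matrix.smul_apply, smul_eq_mul, Complex.im_ofReal_mul, Matrix.transpose_apply, hNreal,
      mul_zero]
  · ext p q
    rw [Matrix.transpose_smul, Matrix.transpose_transpose, Matrix.smul_mul, Matrix.mul_smul,
      Matrix.smul_apply, Matrix.smul_apply, hs, Matrix.one_apply, hst]
    simp only [← Subtype.ext_iff]
    split_ifs
    · simp
      field_simp
    · simp
  · rw [Matrix.mul_smul, Matrix.smul_mul, hcomm']

theorem card_weights (a : ℕ) : (weights a).card = a + 1 := by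
  rw [weights, Finset.card_image_of_injective _ fun i j h => by simpa using h, Finset.card_range]

theorem sum_spins (a b : ℕ) : ∑ c ∈ spins a b, (c + 1) = (a + 1) * (b + 1) := by
  rw [spins, Finset.sum_image]
  · have key : ∀ m n : ℕ, m ≤ n →
        ∑ i ∈ Finset.range (m + 1), (n + m - 2 * i + 1) = (m + 1) * (n + 1) := by
      intro m
      induction m with
      | zero => intro n _; simp
      | succ m ih =>
        intro n hn
        obtain ⟨n, rfl⟩ := Nat.exists_eq_add_of_le' (Nat.one_le_of_lt hn)
        rw [Finset.sum_range_succ']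
        have h1 : ∀ i ∈ Finset.range (m + 1),
            n + 1 + (m + 1) - 2 * (i + 1) + 1 = n + m - 2 * i + 1 := by
          intro i _
          omega
        rw [Finset.sum_congr rfl h1, ih n (by omega)]
        ring_nf
        omega
    rcases le_total a b with h | h
    · rw [min_eq_left h, ← key a b h]
      exact Finset.sum_congr rfl fun i _ => by omega
    · rw [min_eq_right h, mul_comm, ← key b a h]
  · intro i hi j hj hij
    simp only [Finset.coe_range, Set.mem_Iio] at hi hj
    simp only at hij
    omega

theorem card_prod_eq_card_sigma (a b : ℕ) :
    Fintype.card (weights a × weights b) = Fintype.card (Σ c : spins a b, weights c) := by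
  rw [Fintype.card_prod, Fintype.card_sigma]
  simp only [Fintype.card_coe, card_weights]
  rw [Finset.sum_coe_sort (spins a b) fun c => c + 1, sum_spins]

/-- A real orthogonal Clebsch–Gordan matrix. -/
theorem exists_orthogonal_intertwiner (a b : ℕ) :
    ∃ M : ∀ c : spins a b, Matrix (weights a × weights b) (weights c) ℂ,
      (∀ c g, prodWigner a b g * M c = M c * wigner c g) ∧
      IsRealOrthogonal (Matrix.of fun i (j : Σ c : spins a b, weights c) => M j.1 i j.2) := by
  choose M hreal hiso hcomm using fun c : spins a b => exists_isometric_intertwiner c.2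
  have h1 : (Matrix.of fun i (j : Σ c : spins a b, weights c) => M j.1 i j.2)ᵀ *
      (Matrix.of fun i (j : Σ c : spins a b, weights c) => M j.1 i j.2) = 1 := by
    ext ⟨c, p⟩ ⟨d, q⟩
    rw [Matrix.mul_apply]
    simp only [Matrix.transpose_apply, Matrix.of_apply]
    have h2 : ∑ i, M c i p * M d i q = ((M c)ᵀ * M d) p q := by rw [Matrix.mul_apply]; rfl
    rw [h2]
    rcases eq_or_ne c d with rfl | h
    · rw [hiso, Matrix.one_apply, Matrix.one_apply]
      simp
    · obtain ⟨s, hs, hs'⟩ := exists_scalar_transpose_mul (hcomm c) (hcomm d)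
      rw [hs', hs fun h' => h (Subtype.ext h'.symm), Matrix.one_apply_ne]
      · simp
      · simp [h]
  refine ⟨M, hcomm, fun i j => hreal _ _ _, h1, ?_⟩
  -- Orthonormal columns suffice because the dimensions of both sides agree.
  rwa [Matrix.mul_eq_one_comm_of_card_eq]
  exact card_prod_eq_card_sigma a b

theorem nonempty_cgChoice : Nonempty CGChoice := by
  have h : ∀ a b, ∃ B : (sumRep a b).Equiv ((su2Rep a).tprod (su2Rep b)),
      IsRealOrthogonal (LinearMap.toMatrix (sumBasis a b) (prodBasis a b)
        B.toLinearEquiv.toLinearMap) := by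
    intro a b
    obtain ⟨M, hcomm, horth⟩ := exists_orthogonal_intertwiner a b
    set Q := (Matrix.of fun i (j : Σ c : spins a b, weights c) => M j.1 i j.2) with hQ
    let e : SumSpace a b ≃ₗ[ℂ] Spin a ⊗[ℂ] Spin b :=
      Matrix.toLinOfInv (sumBasis a b) (prodBasis a b) horth.2.2 horth.2.1
    have he : e.toLinearMap = Matrix.toLin (sumBasis a b) (prodBasis a b) Q := rfl
    -- Restricted to one summand, the map has the block `M c` as its matrix, so equivariance can be
    -- checked block by block.
    have hlof : ∀ c : spins a b, e.toLinearMap ∘ₗ DirectSum.lof ℂ (spins a b) (fun c => Spin c) c =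
        Matrix.toLin (spinBasis c) (prodBasis a b) (M c) := by
      intro c
      apply (spinBasis c).ext
      intro p
      rw [LinearMap.comp_apply, ← sumBasis_apply a b ⟨c, p⟩, he, Matrix.toLin_self,
        Matrix.toLin_self]
      rfl
    refine ⟨Representation.Equiv.mk e fun u => ?_, ?_⟩
    · apply DirectSum.linearMap_ext
      intro c
      have h1 : sumRep a b u ∘ₗ DirectSum.lof ℂ (spins a b) (fun c => Spin c) c =
          DirectSum.lof ℂ (spins a b) (fun c => Spin c) c ∘ₗ spinRep c (incl u) := by
        ext x : 1
        exact DirectSum.lmap_lof _ _ _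
      rw [LinearMap.comp_assoc, h1, ← LinearMap.comp_assoc, hlof, LinearMap.comp_assoc, hlof]
      apply (LinearMap.toMatrix (spinBasis c) (prodBasis a b)).injective
      rw [LinearMap.toMatrix_comp _ (spinBasis c), LinearMap.toMatrix_comp _ (prodBasis a b),
        LinearMap.toMatrix_toLin]
      exact ((toMatrix_tprod_spinRep a b (incl u)) ▸ hcomm c (incl u)).symm
    · change IsRealOrthogonal (LinearMap.toMatrix (sumBasis a b) (prodBasis a b) e.toLinearMap)
      rw [he, LinearMap.toMatrix_toLin]
      exact horth
  choose B hB using h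
  exact ⟨⟨B, hB⟩⟩

/-! ### Properties of an arbitrary choice of Clebsch–Gordan maps -/

namespace CGChoice

variable (B : CGChoice)

/-- The matrix of the Clebsch–Gordan map in the canonical bases. -/
def matrix (a b : ℕ) : Matrix (weights a × weights b) (Σ c : spins a b, weights c) ℂ :=
  LinearMap.toMatrix (LorentzCG.sumBasis a b) (LorentzCG.prodBasis a b) (B.map a b).toLinearEquiv.toLinearMap

theorem matrix_apply (a b : ℕ) (i : weights a × weights b) (j : Σ c : spins a b, weights c) :
    B.matrix a b i j = (LorentzCG.prodBasis a b).repr (B.map a b (LorentzCG.sumBasis a b j)) i := by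
  rw [matrix, LinearMap.toMatrix_apply]
  rfl

theorem coeff_eq_matrix (a b : ℕ) (p : weights a) (q : weights b)
    (j : Σ c : spins a b, weights c) : B.coeff a p b q j.1 j.2 = B.matrix a b (p, q) j := by
  rw [coeff, dif_pos ⟨⟨p.2, q.2⟩, j.1.2, j.2.2⟩, matrix_apply]

theorem coeff_eq_zero {a b c : ℕ} {p q r : ℤ}
    (h : ¬((p ∈ weights a ∧ q ∈ weights b) ∧ c ∈ spins a b ∧ r ∈ weights c)) :
    B.coeff a p b q c r = 0 := dif_neg h

/-- The restriction of the Clebsch–Gordan map to the copy of the irrep of spin `c / 2`. -/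
def mapSpin (a b : ℕ) (c : spins a b) : Spin c →ₗ[ℂ] Spin a ⊗[ℂ] Spin b :=
  (B.map a b).toLinearEquiv.toLinearMap ∘ₗ DirectSum.lof ℂ (spins a b) (fun c => Spin c) c

theorem mapSpin_spinBasis (a b : ℕ) (c : spins a b) (r : weights c) :
    B.mapSpin a b c (spinBasis c r) = B.map a b (LorentzCG.sumBasis a b ⟨c, r⟩) := by
  rw [LorentzCG.sumBasis_apply]
  rfl

theorem mapSpin_comp_su2Rep (a b : ℕ) (c : spins a b) (u : SU2) :
    B.mapSpin a b c ∘ₗ su2Rep c u = ((su2Rep a).tprod (su2Rep b)) u ∘ₗ B.mapSpin a b c := by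
  ext x : 1
  have h1 := Representation.IntertwiningMap.isIntertwining _ _ (B.map a b).toIntertwiningMap u
    (DirectSum.lof ℂ (spins a b) (fun c => Spin c) c x)
  have h2 : sumRep a b u (DirectSum.lof ℂ (spins a b) (fun c => Spin c) c x) =
      DirectSum.lof ℂ (spins a b) (fun c => Spin c) c (su2Rep c u x) := DirectSum.lmap_lof _ _ _
  rw [h2] at h1
  exact h1

end CGChoice

/-- The diagonal element of `SU(2)` with entries `z` and `z⁻¹`, for `|z| = 1`. -/
theorem exists_incl_eq_torus {z : ℂˣ} (hz : (z : ℂ) * star (z : ℂ) = 1) :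
    ∃ u : SU2, incl u = torus z := by
  refine ⟨su2OfColumn z 0 (by simpa using hz), Subtype.ext ?_⟩
  rw [coe_incl_su2OfColumn, coe_torus, eq_inv_of_mul_eq_one_right hz]
  simp

theorem exists_unit_zpow_ne_one {n : ℤ} (hn : n ≠ 0) :
    ∃ z : ℂˣ, (z : ℂ) * star (z : ℂ) = 1 ∧ (z : ℂ) ^ n ≠ 1 := by
  have h : Complex.exp (Real.pi / n * Complex.I) ≠ 0 := Complex.exp_ne_zero _
  -- The number `exp (π i / n)` has modulus one and `n`-th power `-1`.
  refine ⟨Units.mk0 _ h, ?_, ?_⟩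
  · have h2 : Complex.exp (Real.pi / n * Complex.I) =
        Complex.exp ((Real.pi / n : ℝ) * Complex.I) := by push_cast; rfl
    rw [Units.val_mk0, h2]
    change _ * (starRingEnd ℂ) _ = _
    rw [Complex.mul_conj, Complex.normSq_eq_norm_sq, Complex.norm_exp_ofReal_mul_I]
    simp
  · have hn' : (n : ℂ) ≠ 0 := by exact_mod_cast hn
    rw [Units.val_mk0, ← Complex.exp_int_mul]
    have : (n : ℂ) * (Real.pi / n * Complex.I) = Real.pi * Complex.I := by field_simp
    rw [this, Complex.exp_pi_mul_I]
    norm_num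

theorem eq_of_unit_zpow_eq {m n : ℤ}
    (h : ∀ z : ℂˣ, (z : ℂ) * star (z : ℂ) = 1 → (z : ℂ) ^ m = (z : ℂ) ^ n) : m = n := by
  by_contra hmn
  obtain ⟨z, hz, hz'⟩ := exists_unit_zpow_ne_one (sub_ne_zero.2 hmn)
  apply hz'
  rw [zpow_sub₀ z.ne_zero, h z hz, div_self (zpow_ne_zero _ z.ne_zero)]

theorem tprod_spinRep_torus (a b : ℕ) (z : ℂˣ) (i : weights a × weights b) :
    ((spinRep a).tprod (spinRep b)) (torus z) (LorentzCG.prodBasis a b i) =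
      (z : ℂ) ^ ((i.1 : ℤ) + i.2) • LorentzCG.prodBasis a b i := by
  rw [prodBasis_apply, Representation.tprod_apply, TensorProduct.map_tmul, spinRep_torus,
    spinRep_torus, TensorProduct.tmul_smul, ← TensorProduct.smul_tmul', smul_smul,
    zpow_add₀ z.ne_zero, mul_comm]

namespace CGChoice

variable (B : CGChoice)

/-- Only the diagonal circle lies in `SU(2)`, but its characters already separate integer weights.
-/
theorem matrix_eq_zero {a b : ℕ} {i : weights a × weights b} {j : Σ c : spins a b, weights c}
    (h : (i.1 : ℤ) + i.2 ≠ j.2) : B.matrix a b i j = 0 := by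
  by_contra h0
  apply h
  symm
  apply eq_of_unit_zpow_eq
  intro z hz
  obtain ⟨u, hu⟩ := exists_incl_eq_torus hz
  rw [matrix_apply, ← mapSpin_spinBasis] at h0
  have h1 := B.mapSpin_comp_su2Rep a b j.1 u
  change _ ∘ₗ spinRep j.1 (incl u) = ((spinRep a).tprod (spinRep b)) (incl u) ∘ₗ _ at h1
  rw [hu] at h1
  exact eigenvalue_eq_of_repr_ne_zero (spinBasis j.1) (LorentzCG.prodBasis a b) h1
    (χ := fun p => (z : ℂ) ^ (p : ℤ)) (ψ := fun i => (z : ℂ) ^ ((i.1 : ℤ) + i.2))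
    (spinRep_torus j.1 z) (tprod_spinRep_torus a b z) h0

theorem coeff_eq_zero_of_ne {a b c : ℕ} {p q r : ℤ} (h : p + q ≠ r) :
    B.coeff a p b q c r = 0 := by
  by_cases h' : (p ∈ weights a ∧ q ∈ weights b) ∧ c ∈ spins a b ∧ r ∈ weights c
  · have := B.coeff_eq_matrix a b ⟨p, h'.1.1⟩ ⟨q, h'.1.2⟩ ⟨⟨c, h'.2.1⟩, ⟨r, h'.2.2⟩⟩
    rw [this]
    exact B.matrix_eq_zero h
  · exact B.coeff_eq_zero h'

/-- The Clebsch–Gordan maps of `SU(2)` are equivariant under `SL(2, ℂ)`. -/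
theorem mapSpin_comp_spinRep (a b : ℕ) (c : spins a b) (g : SL2C) :
    B.mapSpin a b c ∘ₗ spinRep c g =
      ((spinRep a).tprod (spinRep b)) g ∘ₗ B.mapSpin a b c := by
  have h : intertwinedSubgroup (spinRep c) ((spinRep a).tprod (spinRep b)) (B.mapSpin a b c) = ⊤ := by
    -- Conservation of weights, obtained from the circle, gives equivariance under the whole complex
    -- torus.
    refine eq_top_of_su2_of_torus (fun u => B.mapSpin_comp_su2Rep a b c u) fun z => ?_
    refine intertwines_of_eigenvalue_eq (spinBasis c) (LorentzCG.prodBasis a b)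
      (χ := fun p => (z : ℂ) ^ (p : ℤ)) (ψ := fun i => (z : ℂ) ^ ((i.1 : ℤ) + i.2))
      (spinRep_torus c z) (tprod_spinRep_torus a b z) fun p i hpi => ?_
    have h1 : (i.1 : ℤ) + i.2 = p := by
      by_contra h2
      apply hpi
      rw [mapSpin_spinBasis, ← matrix_apply]
      exact B.matrix_eq_zero h2
    simp only [h1]
  exact mem_intertwinedSubgroup.1 (h ▸ Subgroup.mem_top g)

theorem matrix_orthogonal (a b : ℕ) : IsRealOrthogonal (B.matrix a b) := B.orthogonal a b

/-- The matrix is orthogonal, so the inverse map has the transposed matrix. -/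
theorem repr_symm (a b : ℕ) (p : weights a) (q : weights b) (j : Σ c : spins a b, weights c) :
    (LorentzCG.sumBasis a b).repr ((B.map a b).symm (LorentzCG.prodBasis a b (p, q))) j =
      B.coeff a p b q j.1 j.2 := by
  rw [coeff_eq_matrix]
  have h1 : LinearMap.toMatrix (LorentzCG.prodBasis a b) (LorentzCG.sumBasis a b)
      (B.map a b).toLinearEquiv.symm.toLinearMap * B.matrix a b = 1 := by
    rw [matrix, ← LinearMap.toMatrix_comp, LinearEquiv.symm_comp, LinearMap.toMatrix_id]
  have h2 : LinearMap.toMatrix (LorentzCG.prodBasis a b) (LorentzCG.sumBasis a b)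
      (B.map a b).toLinearEquiv.symm.toLinearMap = (B.matrix a b)ᵀ := by
    rw [← Matrix.mul_one (LinearMap.toMatrix _ _ _), ← (B.matrix_orthogonal a b).2.2,
      ← Matrix.mul_assoc, h1, Matrix.one_mul]
  have h3 := congrFun (congrFun h2 j) (p, q)
  rw [LinearMap.toMatrix_apply] at h3
  exact h3

theorem basis_apply (k n : ℕ) (j : Σ c : spins k n, weights c) :
    B.basis k n j = B.mapSpin k n j.1 (spinBasis j.1 j.2) := by
  rw [mapSpin_spinBasis, basis, Module.Basis.map_apply]
  rfl

end CGChoice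

/-- For unitary `u` of determinant one the adjoint is the adjugate, and conjugation by `epsilon`
carries the complex conjugate of `u` back to `u`. -/
theorem conjHom_incl (u : SU2) : conjHom (incl u) = incl u := by
  have hu := Matrix.mem_specialUnitaryGroup_iff.1 u.2
  have h1 : star u.1 = u.1.adjugate := by
    rw [← mul_one (star u.1), ← one_smul ℂ (1 : Matrix (Fin 2) (Fin 2) ℂ), ← hu.2,
      ← Matrix.mul_adjugate, ← mul_assoc, Matrix.mem_unitaryGroup_iff'.1 hu.1, one_mul]
  rw [Matrix.adjugate_fin_two] at h1
  change epsilon * Matrix.SpecialLinearGroup.map (starRingEnd ℂ) (incl u) * epsilon⁻¹ = incl u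
  rw [mul_inv_eq_iff_eq_mul]
  apply Subtype.ext
  have h2 := fun i j => congrFun (congrFun h1 i) j
  simp only [Matrix.star_apply] at h2
  change !![0, 1; -1, 0] * u.1.map (starRingEnd ℂ) = u.1 * !![0, 1; -1, 0]
  ext i j
  have h00 := h2 0 0
  have h01 := h2 0 1
  have h10 := h2 1 0
  have h11 := h2 1 1
  simp at h00 h01 h10 h11
  fin_cases i <;> fin_cases j <;> simp [Matrix.mul_apply, Fin.sum_univ_two, *]

theorem CGChoice.TRep_basis (B : CGChoice) (k n : ℕ) (u : SU2) (l : spins k n) (m : weights l) :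
    TRep k n (incl u) (B.basis k n ⟨l, m⟩) =
      ∑ m' : weights l, (spinBasis l).repr (su2Rep l u (spinBasis l m)) m' • B.basis k n ⟨l, m'⟩ := by
  have h1 : TRep k n (incl u) = ((su2Rep k).tprod (su2Rep n)) u := by
    rw [TRep, Representation.tprod_apply, MonoidHom.comp_apply, conjHom_incl]
    rfl
  have h2 := LinearMap.congr_fun (B.mapSpin_comp_su2Rep k n l u) (spinBasis l m)
  simp only [LinearMap.comp_apply] at h2
  simp only [basis_apply]
  rw [h1, ← h2]
  conv_lhs => rw [← (spinBasis l).sum_repr (su2Rep l u (spinBasis l m))]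
  simp only [map_sum, map_smul]

/-! ### Schur's lemma for the irreps of the Lorentz group -/

theorem conjHom_torus (z : ℂˣ) : conjHom (torus z) = torus (star z)⁻¹ := by
  change epsilon * Matrix.SpecialLinearGroup.map (starRingEnd ℂ) (torus z) * epsilon⁻¹ = _
  rw [mul_inv_eq_iff_eq_mul]
  apply Subtype.ext
  change !![0, 1; -1, 0] * (torus z).1.map (starRingEnd ℂ) =
    (torus (star z)⁻¹).1 * !![0, 1; -1, 0]
  rw [coe_torus, coe_torus]
  ext i j
  fin_cases i <;> fin_cases j <;> simp [Matrix.mul_apply, Fin.sum_univ_two]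

theorem TRep_torus (k n : ℕ) (z : ℂˣ) (i : weights k × weights n) :
    TRep k n (torus z) (prodBasis k n i) =
      ((z : ℂ) ^ (i.1 : ℤ) * (star (z : ℂ))⁻¹ ^ (i.2 : ℤ)) • prodBasis k n i := by
  rw [prodBasis_apply, TRep, Representation.tprod_apply, MonoidHom.comp_apply, conjHom_torus,
    TensorProduct.map_tmul, spinRep_torus, spinRep_torus, TensorProduct.tmul_smul,
    ← TensorProduct.smul_tmul', smul_smul, mul_comm]
  simp

theorem TRep_incl (k n : ℕ) (u : SU2) :
    TRep k n (incl u) = TensorProduct.map (spinRep k (incl u)) (spinRep n (incl u)) := by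
  rw [TRep, Representation.tprod_apply, MonoidHom.comp_apply, conjHom_incl]

/-- The action of `SL(2, ℂ)` on the first factor only. -/
def leftRep (k n : ℕ) : Representation ℂ SL2C (TSpace k n) := (spinRep k).tprod 1

/-- The action of `SL(2, ℂ)` on the second factor only. -/
def rightRep (k n : ℕ) : Representation ℂ SL2C (TSpace k n) :=
  Representation.tprod 1 (spinRep n)

theorem leftRep_apply (k n : ℕ) (g : SL2C) :
    leftRep k n g = TensorProduct.map (spinRep k g) LinearMap.id := rfl

theorem rightRep_apply (k n : ℕ) (g : SL2C) :
    rightRep k n g = TensorProduct.map LinearMap.id (spinRep n g) := rfl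

/-- On `SU(2)` both factors see the same element, and its action on the second factor cancels.
One-sided actions are thus conjugated by `TRep` itself, with which intertwiners commute. -/
theorem leftRep_conj (k n : ℕ) (u : SU2) (g : SL2C) :
    leftRep k n (incl u * g * (incl u)⁻¹) =
      TRep k n (incl u) ∘ₗ leftRep k n g ∘ₗ TRep k n (incl u⁻¹) := by
  rw [leftRep_apply, leftRep_apply, TRep_incl, TRep_incl, ← TensorProduct.map_comp,
    ← TensorProduct.map_comp, ← map_inv, mul_assoc, map_mul (spinRep k), map_mul (spinRep k),
    LinearMap.id_comp, ← Module.End.mul_eq_comp (spinRep n (incl u)), ← map_mul (spinRep n),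
    map_inv incl, mul_inv_cancel, map_one]
  rfl

theorem rightRep_conj (k n : ℕ) (u : SU2) (g : SL2C) :
    rightRep k n (incl u * g * (incl u)⁻¹) =
      TRep k n (incl u) ∘ₗ rightRep k n g ∘ₗ TRep k n (incl u⁻¹) := by
  rw [rightRep_apply, rightRep_apply, TRep_incl, TRep_incl, ← TensorProduct.map_comp,
    ← TensorProduct.map_comp, ← map_inv, mul_assoc, map_mul (spinRep n), map_mul (spinRep n),
    LinearMap.id_comp, ← Module.End.mul_eq_comp (spinRep k (incl u)), ← map_mul (spinRep k),
    map_inv incl, mul_inv_cancel, map_one]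
  rfl

theorem leftRep_torus (k n : ℕ) (z : ℂˣ) (i : weights k × weights n) :
    leftRep k n (torus z) (prodBasis k n i) = ((z : ℂ) ^ (i.1 : ℤ)) • prodBasis k n i := by
  rw [prodBasis_apply, leftRep_apply, TensorProduct.map_tmul, spinRep_torus,
    TensorProduct.smul_tmul', LinearMap.id_apply]

theorem rightRep_torus (k n : ℕ) (z : ℂˣ) (i : weights k × weights n) :
    rightRep k n (torus z) (prodBasis k n i) = ((z : ℂ) ^ (i.2 : ℤ)) • prodBasis k n i := by
  rw [prodBasis_apply, rightRep_apply, TensorProduct.map_tmul, spinRep_torus,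
    TensorProduct.tmul_smul, LinearMap.id_apply]

section Schur

variable {k n k' n' : ℕ} {φ : TSpace k n →ₗ[ℂ] TSpace k' n'}

/-- With the indices of the second factor frozen, the matrix of `φ` becomes a matrix between single
spins, to which the earlier Schur lemma applies. -/
theorem slice_comm_left {g : SL2C} (h : φ ∘ₗ leftRep k n g = leftRep k' n' g ∘ₗ φ)
    (q' : weights n') (q : weights n) :
    (Matrix.of fun p' p => LinearMap.toMatrix (prodBasis k n) (prodBasis k' n') φ (p', q') (p, q)) *
        wigner k g = wigner k' g *
      (Matrix.of fun p' p =>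
        LinearMap.toMatrix (prodBasis k n) (prodBasis k' n') φ (p', q') (p, q)) := by
  have h1 := congrArg (LinearMap.toMatrix (prodBasis k n) (prodBasis k' n')) h
  rw [LinearMap.toMatrix_comp _ (prodBasis k n), LinearMap.toMatrix_comp _ (prodBasis k' n'),
    leftRep_apply, leftRep_apply, prodBasis, prodBasis, TensorProduct.toMatrix_map,
    TensorProduct.toMatrix_map, LinearMap.toMatrix_id, LinearMap.toMatrix_id] at h1
  ext p' p
  have h2 := congrFun (congrFun h1 (p', q')) (p, q)
  simpa [Matrix.mul_apply, Fintype.sum_prod_type, Matrix.kroneckerMap_apply, Matrix.one_apply,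
    wigner, prodBasis] using h2

theorem slice_comm_right {g : SL2C} (h : φ ∘ₗ rightRep k n g = rightRep k' n' g ∘ₗ φ)
    (p' : weights k') (p : weights k) :
    (Matrix.of fun q' q => LinearMap.toMatrix (prodBasis k n) (prodBasis k' n') φ (p', q') (p, q)) *
        wigner n g = wigner n' g *
      (Matrix.of fun q' q =>
        LinearMap.toMatrix (prodBasis k n) (prodBasis k' n') φ (p', q') (p, q)) := by
  have h1 := congrArg (LinearMap.toMatrix (prodBasis k n) (prodBasis k' n')) h
  rw [LinearMap.toMatrix_comp _ (prodBasis k n), LinearMap.toMatrix_comp _ (prodBasis k' n'),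
    rightRep_apply, rightRep_apply, prodBasis, prodBasis, TensorProduct.toMatrix_map,
    TensorProduct.toMatrix_map, LinearMap.toMatrix_id, LinearMap.toMatrix_id] at h1
  ext q' q
  have h2 := congrFun (congrFun h1 (p', q')) (p, q)
  simpa [Matrix.mul_apply, Fintype.sum_prod_type, Matrix.kroneckerMap_apply, Matrix.one_apply,
    wigner, prodBasis] using h2

variable (hφ : ∀ g, φ ∘ₗ TRep k n g = TRep k' n' g ∘ₗ φ)
include hφ

/-- The torus acts by `z ^ p * (star z)⁻¹ ^ q`. For `|z| = 1` this is `z ^ (p + q)`, at `z = 2` it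
is `2 ^ (p - q)`; sum and difference determine both weights. -/
theorem weights_eq_of_repr_ne_zero {i : weights k × weights n} {j : weights k' × weights n'}
    (h : (prodBasis k' n').repr (φ (prodBasis k n i)) j ≠ 0) :
    (i.1 : ℤ) = j.1 ∧ (i.2 : ℤ) = j.2 := by
  have h1 := fun z => eigenvalue_eq_of_repr_ne_zero _ _ (hφ (torus z)) (TRep_torus k n z)
    (TRep_torus k' n' z) h
  have h2 : (i.1 : ℤ) + i.2 = j.1 + j.2 := by
    apply eq_of_unit_zpow_eq
    intro z hz
    have h3 := h1 z
    rw [← eq_inv_of_mul_eq_one_left hz] at h3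
    rw [zpow_add₀ z.ne_zero, zpow_add₀ z.ne_zero, h3]
  have h4 : (i.1 : ℤ) - i.2 = j.1 - j.2 := by
    apply zpow_two_injective
    have h3 := h1 (Units.mk0 2 two_ne_zero)
    simp only [Units.val_mk0, star_ofNat, inv_zpow] at h3
    simp only [zpow_sub₀ (two_ne_zero' ℂ), div_eq_mul_inv]
    exact h3
  omega

/-- The elements whose left action commutes with `φ` include the torus, as both weights are
preserved, and are normalized by `SU(2)`; such a subgroup contains the unipotents. This separates
the two factors without passing to Lie algebras. -/
theorem comp_leftRep_upper : φ ∘ₗ leftRep k n (upper 1) = leftRep k' n' (upper 1) ∘ₗ φ := by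
  refine mem_intertwinedSubgroup.1 (upper_mem_of_normalized
    (S := intertwinedSubgroup (leftRep k n) (leftRep k' n') φ) (fun z => ?_) (fun u g hg => ?_) 1)
  · refine intertwines_of_eigenvalue_eq _ _ (leftRep_torus k n z) (leftRep_torus k' n' z)
      fun i j hij => ?_
    simp only [(weights_eq_of_repr_ne_zero hφ hij).1]
  · rw [mem_intertwinedSubgroup] at hg ⊢
    rw [leftRep_conj, leftRep_conj, ← LinearMap.comp_assoc, hφ, LinearMap.comp_assoc,
      ← LinearMap.comp_assoc _ _ φ, hg, LinearMap.comp_assoc, hφ]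
    rfl

theorem comp_rightRep_upper : φ ∘ₗ rightRep k n (upper 1) = rightRep k' n' (upper 1) ∘ₗ φ := by
  refine mem_intertwinedSubgroup.1 (upper_mem_of_normalized
    (S := intertwinedSubgroup (rightRep k n) (rightRep k' n') φ) (fun z => ?_)
    (fun u g hg => ?_) 1)
  · refine intertwines_of_eigenvalue_eq _ _ (rightRep_torus k n z) (rightRep_torus k' n' z)
      fun i j hij => ?_
    simp only [(weights_eq_of_repr_ne_zero hφ hij).2]
  · rw [mem_intertwinedSubgroup] at hg ⊢
    rw [rightRep_conj, rightRep_conj, ← LinearMap.comp_assoc, hφ, LinearMap.comp_assoc,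
      ← LinearMap.comp_assoc _ _ φ, hg, LinearMap.comp_assoc, hφ]
    rfl

theorem comp_leftRep_torus (z : ℂˣ) :
    φ ∘ₗ leftRep k n (torus z) = leftRep k' n' (torus z) ∘ₗ φ :=
  intertwines_of_eigenvalue_eq _ _ (leftRep_torus k n z) (leftRep_torus k' n' z)
    fun i j hij => by simp only [(weights_eq_of_repr_ne_zero hφ hij).1]

theorem comp_rightRep_torus (z : ℂˣ) :
    φ ∘ₗ rightRep k n (torus z) = rightRep k' n' (torus z) ∘ₗ φ :=
  intertwines_of_eigenvalue_eq _ _ (rightRep_torus k n z) (rightRep_torus k' n' z)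
    fun i j hij => by simp only [(weights_eq_of_repr_ne_zero hφ hij).2]

/-- Schur's lemma for different irreps of the Lorentz group. -/
theorem eq_zero_of_TRep (hne : ¬(k = k' ∧ n = n')) : φ = 0 := by
  apply (LinearMap.toMatrix (prodBasis k n) (prodBasis k' n')).injective
  rw [map_zero]
  ext ⟨p', q'⟩ ⟨p, q⟩
  by_cases hk : k = k'
  · have hn : n ≠ n' := fun h => hne ⟨hk, h⟩
    obtain ⟨c, hc, hM⟩ := exists_scalar_of_wigner_comm
      (slice_comm_right (comp_rightRep_torus hφ _) p' p) (slice_comm_right (comp_rightRep_upper hφ) p' p)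
    have := hM q' q
    rw [hc hn] at this
    simpa using this
  · obtain ⟨c, hc, hM⟩ := exists_scalar_of_wigner_comm
      (slice_comm_left (comp_leftRep_torus hφ _) q' q) (slice_comm_left (comp_leftRep_upper hφ) q' q)
    have := hM p' p
    rw [hc hk] at this
    simpa using this

end Schur

/-- Schur's lemma for an irrep of the Lorentz group. -/
theorem exists_eq_smul_of_TRep {k n : ℕ} {φ : TSpace k n →ₗ[ℂ] TSpace k n}
    (hφ : ∀ g, φ ∘ₗ TRep k n g = TRep k n g ∘ₗ φ) : ∃ c : ℂ, ∀ x, φ x = c • x := by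
  set M := LinearMap.toMatrix (prodBasis k n) (prodBasis k n) φ with hMdef
  have hL : ∀ q' q, ∃ c : ℂ, ∀ p' p, M (p', q') (p, q) = if p' = p then c else 0 := fun q' q => by
    obtain ⟨c, -, hM⟩ := exists_scalar_of_wigner_comm
      (slice_comm_left (comp_leftRep_torus hφ _) q' q) (slice_comm_left (comp_leftRep_upper hφ) q' q)
    simp only [← Subtype.ext_iff] at hM
    exact ⟨c, hM⟩
  have hR : ∀ p' p, ∃ c : ℂ, ∀ q' q, M (p', q') (p, q) = if q' = q then c else 0 := fun p' p => by
    obtain ⟨c, -, hM⟩ := exists_scalar_of_wigner_comm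
      (slice_comm_right (comp_rightRep_torus hφ _) p' p) (slice_comm_right (comp_rightRep_upper hφ) p' p)
    simp only [← Subtype.ext_iff] at hM
    exact ⟨c, hM⟩
  choose cL hL using hL
  choose cR hR using hR
  have p₀ : weights k := ⟨k, mem_weights.2 (by omega)⟩
  refine ⟨cR p₀ p₀, fun x => ?_⟩
  have h : M = cR p₀ p₀ • (1 : Matrix (weights k × weights n) (weights k × weights n) ℂ) := by
    ext ⟨p', q'⟩ ⟨p, q⟩
    -- Every entry has the form `δ p' p * cL q' q` and also `δ q' q * cR p' p`; comparing them at
    -- `p' = p = p₀` leaves a single constant.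
    have h1 : cL q' q = if q' = q then cR p₀ p₀ else 0 := by
      rw [← hR, hL, if_pos rfl]
    rw [hL, h1, Matrix.smul_apply, Matrix.one_apply]
    by_cases hp : p' = p <;> by_cases hq : q' = q <;> simp [hp, hq]
  have h2 : φ = cR p₀ p₀ • LinearMap.id := by
    apply (LinearMap.toMatrix (prodBasis k n) (prodBasis k n)).injective
    rw [map_smul, LinearMap.toMatrix_id]
    exact h
  rw [h2]
  rfl

/-! ### Real orthogonal matrices -/

namespace IsRealOrthogonal

variable {ι κ μ ν : Type} [Fintype ι] [Fintype κ] [Fintype μ] [Fintype ν] [DecidableEq ι]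
  [DecidableEq κ] [DecidableEq μ] [DecidableEq ν]

theorem transpose {M : Matrix ι κ ℂ} (hM : IsRealOrthogonal M) : IsRealOrthogonal Mᵀ :=
  ⟨fun i j => hM.1 j i, by rw [Matrix.transpose_transpose]; exact hM.2.2,
    by rw [Matrix.transpose_transpose]; exact hM.2.1⟩

theorem mul {M : Matrix ι κ ℂ} {N : Matrix κ μ ℂ} (hM : IsRealOrthogonal M)
    (hN : IsRealOrthogonal N) : IsRealOrthogonal (M * N) := by
  refine ⟨fun i j => ?_, ?_, ?_⟩
  · rw [Matrix.mul_apply, Complex.im_sum]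
    exact Finset.sum_eq_zero fun k _ => by rw [Complex.mul_im, hM.1, hN.1]; simp
  · rw [Matrix.transpose_mul, Matrix.mul_assoc, ← Matrix.mul_assoc Mᵀ, hM.2.1, Matrix.one_mul,
      hN.2.1]
  · rw [Matrix.transpose_mul, Matrix.mul_assoc, ← Matrix.mul_assoc N, hN.2.2, Matrix.one_mul,
      hM.2.2]

theorem kronecker {M : Matrix ι κ ℂ} {N : Matrix μ ν ℂ} (hM : IsRealOrthogonal M)
    (hN : IsRealOrthogonal N) : IsRealOrthogonal (M ⊗ₖ N) := by
  refine ⟨fun i j => ?_, ?_, ?_⟩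
  · rw [Matrix.kroneckerMap_apply, Complex.mul_im, hM.1, hN.1]
    simp
  · rw [← Matrix.kroneckerMap_transpose, ← Matrix.mul_kronecker_mul, hM.2.1, hN.2.1,
      Matrix.one_kronecker_one]
  · rw [← Matrix.kroneckerMap_transpose, ← Matrix.mul_kronecker_mul, hM.2.2, hN.2.2,
      Matrix.one_kronecker_one]

theorem submatrix {M : Matrix ι κ ℂ} (hM : IsRealOrthogonal M) (e : μ ≃ ι) (f : ν ≃ κ) :
    IsRealOrthogonal (M.submatrix e f) := by
  refine ⟨fun i j => hM.1 _ _, ?_, ?_⟩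
  · rw [Matrix.transpose_submatrix, Matrix.submatrix_mul_equiv, hM.2.1, Matrix.submatrix_one_equiv]
  · rw [Matrix.transpose_submatrix, Matrix.submatrix_mul_equiv, hM.2.2, Matrix.submatrix_one_equiv]

theorem blockDiagonal' {α β : ι → Type} [∀ i, Fintype (α i)] [∀ i, Fintype (β i)]
    [∀ i, DecidableEq (α i)] [∀ i, DecidableEq (β i)] {M : ∀ i, Matrix (α i) (β i) ℂ}
    (hM : ∀ i, IsRealOrthogonal (M i)) : IsRealOrthogonal (Matrix.blockDiagonal' M) := by
  refine ⟨fun i j => ?_, ?_, ?_⟩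
  · rw [Matrix.blockDiagonal'_apply]
    split_ifs
    · exact (hM _).1 _ _
    · rfl
  · rw [Matrix.blockDiagonal'_transpose, ← Matrix.blockDiagonal'_mul]
    simp only [(hM _).2.1]
    exact Matrix.blockDiagonal'_one
  · rw [Matrix.blockDiagonal'_transpose, ← Matrix.blockDiagonal'_mul]
    simp only [(hM _).2.2]
    exact Matrix.blockDiagonal'_one

end IsRealOrthogonal

/-! ### The Clebsch–Gordan map of the Lorentz group -/

variable (B : CGChoice) (k₁ n₁ k₂ n₂ : ℕ)

/-- The restriction of the Clebsch–Gordan map of the Lorentz group to `T^{(k,n)}`. -/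
def lorentzBlock (s : spins k₁ k₂ × spins n₁ n₂) :
    TSpace s.1 s.2 →ₗ[ℂ] TSpace k₁ n₁ ⊗[ℂ] TSpace k₂ n₂ :=
  (TensorProduct.tensorTensorTensorComm ℂ (Spin k₁) (Spin k₂) (Spin n₁) (Spin n₂)).toLinearMap ∘ₗ
    TensorProduct.map (B.mapSpin k₁ k₂ s.1) (B.mapSpin n₁ n₂ s.2)

/-- The underlying linear equivalence of the Clebsch–Gordan map of the Lorentz group. -/
def lorentzLinearEquiv : TSumSpace k₁ n₁ k₂ n₂ ≃ₗ[ℂ] TSpace k₁ n₁ ⊗[ℂ] TSpace k₂ n₂ :=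
  (TensorProduct.directSum ℂ ℂ (fun k : spins k₁ k₂ => Spin k) fun n : spins n₁ n₂ => Spin n).symm ≪≫ₗ
    TensorProduct.congr (B.map k₁ k₂).toLinearEquiv (B.map n₁ n₂).toLinearEquiv ≪≫ₗ
    TensorProduct.tensorTensorTensorComm ℂ (Spin k₁) (Spin k₂) (Spin n₁) (Spin n₂)

/-- The inclusion of `T^{(k,n)}` in the direct sum. -/
def includeT (s : spins k₁ k₂ × spins n₁ n₂) : TSpace s.1 s.2 →ₗ[ℂ] TSumSpace k₁ n₁ k₂ n₂ :=
  DirectSum.lof ℂ (spins k₁ k₂ × spins n₁ n₂) (fun s => TSpace s.1 s.2) s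

theorem lorentzLinearEquiv_comp_includeT (s : spins k₁ k₂ × spins n₁ n₂) :
    (lorentzLinearEquiv B k₁ n₁ k₂ n₂).toLinearMap ∘ₗ includeT k₁ n₁ k₂ n₂ s =
      lorentzBlock B k₁ n₁ k₂ n₂ s := by
  apply TensorProduct.ext'
  intro x y
  have h : (TensorProduct.directSum ℂ ℂ (fun k : spins k₁ k₂ => Spin k)
      fun n : spins n₁ n₂ => Spin n).symm (includeT k₁ n₁ k₂ n₂ s (x ⊗ₜ y)) =
      DirectSum.lof ℂ (spins k₁ k₂) (fun k => Spin k) s.1 x ⊗ₜ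
        DirectSum.lof ℂ (spins n₁ n₂) (fun n => Spin n) s.2 y :=
    TensorProduct.directSum_symm_lof_tmul _ _ _ _ _ _
  rw [LinearMap.comp_apply, LinearEquiv.coe_coe, lorentzLinearEquiv, LinearEquiv.trans_apply,
    LinearEquiv.trans_apply, h]
  rfl

theorem TSumRep_comp_includeT (s : spins k₁ k₂ × spins n₁ n₂) (g : SL2C) :
    TSumRep k₁ n₁ k₂ n₂ g ∘ₗ includeT k₁ n₁ k₂ n₂ s = includeT k₁ n₁ k₂ n₂ s ∘ₗ TRep s.1 s.2 g := by
  apply LinearMap.ext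
  intro x
  exact DirectSum.lmap_lof _ _ _

/-- The unconjugated factors see `g` and the conjugated ones `conjHom g`, so equivariance of the CG
maps under all of `SL(2, ℂ)` is needed at both elements. -/
theorem lorentzBlock_comp_TRep (s : spins k₁ k₂ × spins n₁ n₂) (g : SL2C) :
    lorentzBlock B k₁ n₁ k₂ n₂ s ∘ₗ TRep s.1 s.2 g =
      ((TRep k₁ n₁).tprod (TRep k₂ n₂)) g ∘ₗ lorentzBlock B k₁ n₁ k₂ n₂ s := by
  have h1 : TRep s.1 s.2 g = TensorProduct.map (spinRep s.1 g) (spinRep s.2 (conjHom g)) := rfl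
  have h2 : ((TRep k₁ n₁).tprod (TRep k₂ n₂)) g ∘ₗ (TensorProduct.tensorTensorTensorComm ℂ (Spin k₁)
        (Spin k₂) (Spin n₁) (Spin n₂)).toLinearMap =
      (TensorProduct.tensorTensorTensorComm ℂ (Spin k₁) (Spin k₂) (Spin n₁) (Spin n₂)).toLinearMap ∘ₗ
        TensorProduct.map (((spinRep k₁).tprod (spinRep k₂)) g)
          (((spinRep n₁).tprod (spinRep n₂)) (conjHom g)) := by
    apply TensorProduct.ext_fourfold'
    intro x y z w
    rfl
  rw [lorentzBlock, ← LinearMap.comp_assoc, h2, LinearMap.comp_assoc, LinearMap.comp_assoc, h1,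
    ← TensorProduct.map_comp, ← TensorProduct.map_comp, B.mapSpin_comp_spinRep,
    B.mapSpin_comp_spinRep]

/-- The Clebsch–Gordan map of the Lorentz group. -/
def lorentzMap : LorentzCGMap k₁ n₁ k₂ n₂ :=
  Representation.Equiv.mk (lorentzLinearEquiv B k₁ n₁ k₂ n₂) fun g => by
    apply DirectSum.linearMap_ext
    intro s
    change (_ ∘ₗ _) ∘ₗ includeT k₁ n₁ k₂ n₂ s = (_ ∘ₗ _) ∘ₗ includeT k₁ n₁ k₂ n₂ s
    rw [LinearMap.comp_assoc, TSumRep_comp_includeT, ← LinearMap.comp_assoc,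
      lorentzLinearEquiv_comp_includeT, LinearMap.comp_assoc, lorentzLinearEquiv_comp_includeT,
      lorentzBlock_comp_TRep]

theorem lorentzMap_includeT (s : spins k₁ k₂ × spins n₁ n₂) (x : TSpace s.1 s.2) :
    lorentzMap B k₁ n₁ k₂ n₂ (includeT k₁ n₁ k₂ n₂ s x) = lorentzBlock B k₁ n₁ k₂ n₂ s x :=
  LinearMap.congr_fun (lorentzLinearEquiv_comp_includeT B k₁ n₁ k₂ n₂ s) x

theorem CGChoice.sumBasis_apply' (j : ColIndex k₁ n₁ k₂ n₂) :
    B.sumBasis k₁ n₁ k₂ n₂ j = includeT k₁ n₁ k₂ n₂ j.1 (B.basis j.1.1 j.1.2 j.2) :=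
  dfinsuppBasis_apply (V := fun s : spins k₁ k₂ × spins n₁ n₂ => TSpace s.1 s.2)
    (fun s => B.basis s.1 s.2) j

theorem CGChoice.basis_eq_sum (k n : ℕ) (j : Σ c : spins k n, weights c) :
    B.basis k n j = ∑ i, B.matrix k n i j • LorentzCG.prodBasis k n i := by
  rw [← (LorentzCG.prodBasis k n).sum_repr (B.basis k n j)]
  refine Finset.sum_congr rfl fun i _ => ?_
  rw [matrix_apply, basis_apply, mapSpin_spinBasis]

theorem CGChoice.mapSpin_eq_sum (a b : ℕ) (c : spins a b) (r : weights c) :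
    B.mapSpin a b c (spinBasis c r) =
      ∑ i, B.matrix a b i ⟨c, r⟩ • LorentzCG.prodBasis a b i := by
  rw [← basis_eq_sum, basis_apply]

/-- Orthogonality again: expanding products in canonical vectors uses the same coefficients, so no
inverse coefficients enter the formula. -/
theorem CGChoice.basis_repr (k n : ℕ) (i : weights k × weights n)
    (j : Σ c : spins k n, weights c) :
    (B.basis k n).repr (LorentzCG.prodBasis k n i) j = B.matrix k n i j := by
  rw [← coeff_eq_matrix, ← repr_symm]
  rfl

theorem repr_lorentzBlock (s : spins k₁ k₂ × spins n₁ n₂) (x : weights s.1 × weights s.2)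
    (i : RowIndex k₁ n₁ k₂ n₂) :
    (B.prodBasis k₁ n₁ k₂ n₂).repr (lorentzBlock B k₁ n₁ k₂ n₂ s (prodBasis s.1 s.2 x)) i =
      ∑ p : weights k₁ × weights k₂, ∑ q : weights n₁ × weights n₂,
        (B.matrix k₁ k₂ p ⟨s.1, x.1⟩ * B.matrix n₁ n₂ q ⟨s.2, x.2⟩) *
          (B.matrix k₁ n₁ (p.1, q.1) i.1 * B.matrix k₂ n₂ (p.2, q.2) i.2) := by
  rw [lorentzBlock, LinearMap.comp_apply, prodBasis_apply, TensorProduct.map_tmul,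
    B.mapSpin_eq_sum, B.mapSpin_eq_sum, TensorProduct.sum_tmul]
  simp only [TensorProduct.tmul_sum, map_sum, Finsupp.coe_finsetSum, Finset.sum_apply]
  refine Finset.sum_congr rfl fun p _ => Finset.sum_congr rfl fun q _ => ?_
  rw [TensorProduct.tmul_smul, ← TensorProduct.smul_tmul', map_smul, map_smul, map_smul, map_smul,
    prodBasis_apply, prodBasis_apply]
  have h : (TensorProduct.tensorTensorTensorComm ℂ (Spin k₁) (Spin k₂) (Spin n₁) (Spin n₂)).toLinearMap
      ((spinBasis k₁ p.1 ⊗ₜ spinBasis k₂ p.2) ⊗ₜ (spinBasis n₁ q.1 ⊗ₜ spinBasis n₂ q.2)) =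
      prodBasis k₁ n₁ (p.1, q.1) ⊗ₜ prodBasis k₂ n₂ (p.2, q.2) := by
    rw [prodBasis_apply, prodBasis_apply]
    rfl
  rw [h, CGChoice.prodBasis, Finsupp.smul_apply, Finsupp.smul_apply,
    Module.Basis.tensorProduct_repr_tmul_apply, B.basis_repr, B.basis_repr]
  simp only [smul_eq_mul]
  ring

theorem lorentzCoeff_lorentzMap (i : RowIndex k₁ n₁ k₂ n₂) (j : ColIndex k₁ n₁ k₂ n₂) :
    B.lorentzCoeff (lorentzMap B k₁ n₁ k₂ n₂) i j =
      ∑ x : weights j.1.1 × weights j.1.2, B.matrix j.1.1 j.1.2 x j.2 *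
        ∑ p : weights k₁ × weights k₂, ∑ q : weights n₁ × weights n₂,
          (B.matrix k₁ k₂ p ⟨j.1.1, x.1⟩ * B.matrix n₁ n₂ q ⟨j.1.2, x.2⟩) *
            (B.matrix k₁ n₁ (p.1, q.1) i.1 * B.matrix k₂ n₂ (p.2, q.2) i.2) := by
  rw [CGChoice.lorentzCoeff, B.sumBasis_apply', lorentzMap_includeT, B.basis_eq_sum]
  simp only [map_sum, map_smul, Finsupp.coe_finsetSum, Finset.sum_apply, Finsupp.smul_apply,
    repr_lorentzBlock, smul_eq_mul]

/-- The rearrangement of the indices of `T^{(k₁,n₁)} ⊗ T^{(k₂,n₂)}`. -/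
def rowEquiv : (weights k₁ × weights n₁) × (weights k₂ × weights n₂) ≃
    (weights k₁ × weights k₂) × (weights n₁ × weights n₂) :=
  Equiv.prodProdProdComm _ _ _ _

/-- The rearrangement of the indices of the direct sum of the `T^{(k,n)}`. -/
def colEquiv : (Σ s : spins k₁ k₂ × spins n₁ n₂, weights s.1 × weights s.2) ≃
    (Σ c : spins k₁ k₂, weights c) × (Σ c : spins n₁ n₂, weights c) where
  toFun x := (⟨x.1.1, x.2.1⟩, ⟨x.1.2, x.2.2⟩)
  invFun x := ⟨(x.1.1, x.2.1), (x.1.2, x.2.2)⟩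
  left_inv _ := rfl
  right_inv _ := rfl

/-- Read from the right: expand the canonical vectors of `T^{(k,n)}` in products, apply the two CG
maps and reorder the factors, then return to canonical vectors. Each factor is visibly orthogonal.
-/
theorem lorentzCoeff_lorentzMap_eq_mul : B.lorentzCoeff (lorentzMap B k₁ n₁ k₂ n₂) =
    (B.matrix k₁ n₁ ⊗ₖ B.matrix k₂ n₂)ᵀ *
      ((B.matrix k₁ k₂ ⊗ₖ B.matrix n₁ n₂).submatrix (rowEquiv k₁ n₁ k₂ n₂) (colEquiv k₁ n₁ k₂ n₂) *
        Matrix.blockDiagonal' fun s : spins k₁ k₂ × spins n₁ n₂ => B.matrix s.1 s.2) := by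
  ext i ⟨s, j⟩
  rw [lorentzCoeff_lorentzMap, ← Matrix.mul_assoc, Matrix.mul_apply, Fintype.sum_sigma,
    Finset.sum_eq_single s]
  · refine Finset.sum_congr rfl fun x _ => ?_
    rw [Matrix.blockDiagonal'_apply_eq, mul_comm, Matrix.mul_apply, ← Fintype.sum_prod_type']
    congr 1
    refine Fintype.sum_equiv (rowEquiv k₁ n₁ k₂ n₂).symm _ _ fun y => ?_
    rw [mul_comm]
    rfl
  · intro s' _ hs'
    exact Finset.sum_eq_zero fun x _ => by
      rw [Matrix.blockDiagonal'_apply_ne _ _ _ hs', mul_zero]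
  · simp

theorem isRealOrthogonal_lorentzCoeff :
    IsRealOrthogonal (B.lorentzCoeff (lorentzMap B k₁ n₁ k₂ n₂)) := by
  rw [lorentzCoeff_lorentzMap_eq_mul]
  exact ((B.matrix_orthogonal k₁ n₁).kronecker (B.matrix_orthogonal k₂ n₂)).transpose.mul
    ((((B.matrix_orthogonal k₁ k₂).kronecker (B.matrix_orthogonal n₁ n₂)).submatrix _ _).mul
      (IsRealOrthogonal.blockDiagonal' fun s => B.matrix_orthogonal s.1 s.2))

/-! ### Reduction to the double sum -/

theorem sum_weights_eq {a : ℕ} (f : ℤ → ℂ) (p₀ : ℤ) (h : ∀ p, p ≠ p₀ → f p = 0)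
    (h₀ : p₀ ∉ weights a → f p₀ = 0) : ∑ p : weights a, f p = f p₀ := by
  rw [Finset.sum_coe_sort (weights a) f]
  exact Finset.sum_eq_single p₀ (fun p _ hp => h p hp) h₀

/-- Weight conservation fixes four of the six magnetic numbers once `p₁` and `p₂` are given.
Membership is part of `hF` so that determined values outside the weight ranges contribute zero. -/
theorem sum_weights_collapse {k n : ℕ} (m m₁ m₂ : ℤ) (F : ℤ → ℤ → ℤ → ℤ → ℤ → ℤ → ℂ)
    (hF : ∀ a b p₁ p₂ q₁ q₂, ¬(a = p₁ + p₂ ∧ b = m - a ∧ q₁ = m₁ - p₁ ∧ q₂ = m₂ - p₂ ∧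
      a ∈ weights k ∧ b ∈ weights n ∧ q₁ ∈ weights n₁ ∧ q₂ ∈ weights n₂) →
        F a b p₁ p₂ q₁ q₂ = 0) :
    ∑ a : weights k, ∑ b : weights n, ∑ p₁ : weights k₁, ∑ p₂ : weights k₂,
      ∑ q₁ : weights n₁, ∑ q₂ : weights n₂, F a b p₁ p₂ q₁ q₂ =
    ∑ x ∈ weights k₁ ×ˢ weights k₂,
      F (x.1 + x.2) (m - x.1 - x.2) x.1 x.2 (m₁ - x.1) (m₂ - x.2) := by
  have step : ∀ p₁ p₂ : ℤ, ∑ a : weights k, ∑ b : weights n, ∑ q₁ : weights n₁,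
      ∑ q₂ : weights n₂, F a b p₁ p₂ q₁ q₂ =
        F (p₁ + p₂) (m - p₁ - p₂) p₁ p₂ (m₁ - p₁) (m₂ - p₂) := by
    intro p₁ p₂
    have s1 : ∀ a b q₁, ∑ q₂ : weights n₂, F a b p₁ p₂ q₁ q₂ = F a b p₁ p₂ q₁ (m₂ - p₂) :=
      fun a b q₁ => sum_weights_eq (F a b p₁ p₂ q₁) (m₂ - p₂)
        (fun q h => hF _ _ _ _ _ _ fun h' => h h'.2.2.2.1)
        fun h => hF _ _ _ _ _ _ fun h' => h h'.2.2.2.2.2.2.2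
    have s2 : ∀ a b, ∑ q₁ : weights n₁, F a b p₁ p₂ q₁ (m₂ - p₂) =
        F a b p₁ p₂ (m₁ - p₁) (m₂ - p₂) :=
      fun a b => sum_weights_eq (fun q₁ => F a b p₁ p₂ q₁ (m₂ - p₂)) (m₁ - p₁)
        (fun q h => hF _ _ _ _ _ _ fun h' => h h'.2.2.1)
        fun h => hF _ _ _ _ _ _ fun h' => h h'.2.2.2.2.2.2.1
    have s3 : ∀ a, ∑ b : weights n, F a b p₁ p₂ (m₁ - p₁) (m₂ - p₂) =
        F a (m - a) p₁ p₂ (m₁ - p₁) (m₂ - p₂) :=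
      fun a => sum_weights_eq (fun b => F a b p₁ p₂ (m₁ - p₁) (m₂ - p₂)) (m - a)
        (fun q h => hF _ _ _ _ _ _ fun h' => h h'.2.1)
        fun h => hF _ _ _ _ _ _ fun h' => h h'.2.2.2.2.2.1
    simp only [s1, s2, s3]
    rw [sum_weights_eq (fun a => F a (m - a) p₁ p₂ (m₁ - p₁) (m₂ - p₂)) (p₁ + p₂)
      (fun q h => hF _ _ _ _ _ _ fun h' => h h'.1)
      fun h => hF _ _ _ _ _ _ fun h' => h h'.2.2.2.2.1, sub_sub]
  have c1 : ∀ a : weights k, ∑ b : weights n, ∑ p₁ : weights k₁, ∑ p₂ : weights k₂,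
      ∑ q₁ : weights n₁, ∑ q₂ : weights n₂, F a b p₁ p₂ q₁ q₂ =
      ∑ p₁ : weights k₁, ∑ p₂ : weights k₂, ∑ b : weights n,
      ∑ q₁ : weights n₁, ∑ q₂ : weights n₂, F a b p₁ p₂ q₁ q₂ := fun a => by
    rw [Finset.sum_comm]
    exact Finset.sum_congr rfl fun p₁ _ => Finset.sum_comm
  simp only [c1]
  rw [Finset.sum_comm, Finset.sum_product, ← Finset.sum_coe_sort (weights k₁)]
  refine Finset.sum_congr rfl fun p₁ _ => ?_
  rw [Finset.sum_comm, ← Finset.sum_coe_sort (weights k₂)]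
  exact Finset.sum_congr rfl fun p₂ _ => step p₁ p₂

/-- The summand of the formula, with independent magnetic numbers. -/
def formulaSummand (k n l l₁ l₂ : ℕ) (m m₁ m₂ a b p₁ p₂ q₁ q₂ : ℤ) : ℂ :=
  B.coeff k a n b l m * (B.coeff k₁ p₁ k₂ p₂ k a * B.coeff n₁ q₁ n₂ q₂ n b *
    (B.coeff k₁ p₁ n₁ q₁ l₁ m₁ * B.coeff k₂ p₂ n₂ q₂ l₂ m₂))

theorem formulaSummand_ne_zero {k n l l₁ l₂ : ℕ} {m m₁ m₂ a b p₁ p₂ q₁ q₂ : ℤ}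
    (h : formulaSummand B k₁ n₁ k₂ n₂ k n l l₁ l₂ m m₁ m₂ a b p₁ p₂ q₁ q₂ ≠ 0) :
    a = p₁ + p₂ ∧ b = m - a ∧ q₁ = m₁ - p₁ ∧ q₂ = m₂ - p₂ ∧
      a ∈ weights k ∧ b ∈ weights n ∧ q₁ ∈ weights n₁ ∧ q₂ ∈ weights n₂ := by
  simp only [formulaSummand, ne_eq, mul_eq_zero, not_or] at h
  obtain ⟨h1, ⟨h2, h3⟩, h4, h5⟩ := h
  have e1 := not_imp_comm.1 B.coeff_eq_zero_of_ne h1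
  have e2 := not_imp_comm.1 B.coeff_eq_zero_of_ne h2
  have e4 := not_imp_comm.1 B.coeff_eq_zero_of_ne h4
  have e5 := not_imp_comm.1 B.coeff_eq_zero_of_ne h5
  have w1 := not_imp_comm.1 B.coeff_eq_zero h1
  have w3 := not_imp_comm.1 B.coeff_eq_zero h3
  exact ⟨by omega, by omega, by omega, by omega, w1.1.1, w1.1.2, w3.1.1, w3.1.2⟩

theorem lorentzCoeff_lorentzMap_eq_formula :
    B.lorentzCoeff (lorentzMap B k₁ n₁ k₂ n₂) = B.formulaMatrix k₁ n₁ k₂ n₂ := by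
  ext ⟨⟨l₁, m₁⟩, ⟨l₂, m₂⟩⟩ ⟨⟨k, n⟩, ⟨l, m⟩⟩
  rw [lorentzCoeff_lorentzMap]
  simp only [Fintype.sum_prod_type, ← B.coeff_eq_matrix, Finset.mul_sum]
  refine (sum_weights_collapse k₁ n₁ k₂ n₂ m m₁ m₂
    (formulaSummand B k₁ n₁ k₂ n₂ k n l l₁ l₂ m m₁ m₂) fun a b p₁ p₂ q₁ q₂ h =>
      by_contra fun h' => h (formulaSummand_ne_zero B k₁ n₁ k₂ n₂ h')).trans ?_
  rw [CGChoice.formulaMatrix, CGChoice.formula, sumRange]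
  have key : ∀ x : ℤ × ℤ, formulaSummand B k₁ n₁ k₂ n₂ k n l l₁ l₂ m m₁ m₂ (x.1 + x.2)
      (m - x.1 - x.2) x.1 x.2 (m₁ - x.1) (m₂ - x.2) =
      B.coeff k (x.1 + x.2) n (m - x.1 - x.2) l m * B.coeff k₁ x.1 k₂ x.2 k (x.1 + x.2) *
        B.coeff n₁ (m₁ - x.1) n₂ (m₂ - x.2) n (m - x.1 - x.2) *
        B.coeff k₁ x.1 n₁ (m₁ - x.1) l₁ m₁ * B.coeff k₂ x.2 n₂ (m₂ - x.2) l₂ m₂ := by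
    intro x
    rw [formulaSummand]
    ring
  simp only [← key]
  -- The inequalities in `sumRange` discard only zero summands, as coefficients with indices out of
  -- range are zero by definition.
  rw [Finset.sum_filter_of_ne]
  intro x _ hx
  obtain ⟨-, -, -, -, h1, h2, h3, h4⟩ := formulaSummand_ne_zero B k₁ n₁ k₂ n₂ hx
  rw [mem_weights] at h1 h2 h3 h4
  omega

theorem CGChoice.formulaMatrix_eq_zero (i : RowIndex k₁ n₁ k₂ n₂) (j : ColIndex k₁ n₁ k₂ n₂)
    (h : (i.1.2 : ℤ) + (i.2.2 : ℤ) ≠ (j.2.2 : ℤ)) : B.formulaMatrix k₁ n₁ k₂ n₂ i j = 0 := by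
  rw [formulaMatrix, formula]
  refine Finset.sum_eq_zero fun x _ => ?_
  -- The third coefficient violates weight conservation in every summand, because the primed numbers
  -- cancel.
  rw [B.coeff_eq_zero_of_ne (a := n₁) (b := n₂) (by omega)]
  simp

/-! ### Uniqueness up to constants -/

/-- Uniqueness of the Clebsch–Gordan map of the Lorentz group. -/
theorem exists_scalars (H H₀ : LorentzCGMap k₁ n₁ k₂ n₂) (s : spins k₁ k₂ × spins n₁ n₂) :
    ∃ c : ℂ, ∀ x, H (includeT k₁ n₁ k₂ n₂ s x) = c • H₀ (includeT k₁ n₁ k₂ n₂ s x) := by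
  -- The comparison of the two maps is an equivariant endomorphism of a multiplicity-free sum: its
  -- off-diagonal blocks vanish and its diagonal blocks are scalars.
  let ψ : TSumSpace k₁ n₁ k₂ n₂ →ₗ[ℂ] TSumSpace k₁ n₁ k₂ n₂ :=
    H₀.symm.toLinearEquiv.toLinearMap ∘ₗ H.toLinearEquiv.toLinearMap
  have hψ : ∀ g, ψ ∘ₗ TSumRep k₁ n₁ k₂ n₂ g = TSumRep k₁ n₁ k₂ n₂ g ∘ₗ ψ := fun g => by
    apply LinearMap.ext
    intro x
    have h1 := Representation.IntertwiningMap.isIntertwining _ _ H.toIntertwiningMap g x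
    have h2 := Representation.IntertwiningMap.isIntertwining _ _ H₀.symm.toIntertwiningMap g (H x)
    exact (congrArg H₀.symm h1).trans h2
  let π : ∀ t : spins k₁ k₂ × spins n₁ n₂, TSumSpace k₁ n₁ k₂ n₂ →ₗ[ℂ] TSpace t.1 t.2 := fun t =>
    DirectSum.component ℂ (spins k₁ k₂ × spins n₁ n₂) (fun s => TSpace s.1 s.2) t
  have hπ : ∀ t g, π t ∘ₗ TSumRep k₁ n₁ k₂ n₂ g = TRep t.1 t.2 g ∘ₗ π t := fun t g => rfl
  have hcomm : ∀ t g, (π t ∘ₗ ψ ∘ₗ includeT k₁ n₁ k₂ n₂ s) ∘ₗ TRep s.1 s.2 g =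
      TRep t.1 t.2 g ∘ₗ (π t ∘ₗ ψ ∘ₗ includeT k₁ n₁ k₂ n₂ s) := fun t g => by
    rw [LinearMap.comp_assoc, LinearMap.comp_assoc, ← TSumRep_comp_includeT,
      ← LinearMap.comp_assoc _ _ ψ, hψ, LinearMap.comp_assoc, ← LinearMap.comp_assoc, hπ,
      LinearMap.comp_assoc]
  obtain ⟨c, hc⟩ := exists_eq_smul_of_TRep (hcomm s)
  refine ⟨c, fun x => ?_⟩
  have h1 : ψ (includeT k₁ n₁ k₂ n₂ s x) = c • includeT k₁ n₁ k₂ n₂ s x := by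
    apply DFinsupp.ext
    intro t
    change π t (ψ (includeT k₁ n₁ k₂ n₂ s x)) = π t (c • includeT k₁ n₁ k₂ n₂ s x)
    rw [map_smul]
    rcases eq_or_ne t s with rfl | hts
    · have h3 : π t (includeT k₁ n₁ k₂ n₂ t x) = x := DFinsupp.single_eq_same
      rw [h3]
      exact hc x
    · have h2 := eq_zero_of_TRep (hcomm t) fun h =>
        hts (Prod.ext (Subtype.ext h.1.symm) (Subtype.ext h.2.symm))
      have h3 : π t (includeT k₁ n₁ k₂ n₂ s x) = 0 :=
        DFinsupp.single_eq_of_ne hts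
      rw [h3, smul_zero]
      exact LinearMap.congr_fun h2 x
  have h2 : H₀ (ψ (includeT k₁ n₁ k₂ n₂ s x)) = c • H₀ (includeT k₁ n₁ k₂ n₂ s x) :=
    (congrArg H₀ h1).trans (map_smul H₀ c _)
  rw [← h2]
  exact (H₀.apply_symm_apply _).symm

theorem nonempty_spins (a b : ℕ) : Nonempty (spins a b) :=
  ⟨⟨a + b, mem_spins.2 (by omega)⟩⟩

theorem nonempty_weights (a : ℕ) : Nonempty (weights a) :=
  ⟨⟨a, mem_weights.2 (by omega)⟩⟩

theorem CGChoice.exists_scalars (H : LorentzCGMap k₁ n₁ k₂ n₂) :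
    ∃ c : spins k₁ k₂ × spins n₁ n₂ → ℂ,
      (∀ s, c s ≠ 0) ∧
      (∀ i j, B.lorentzCoeff H i j = c j.1 * B.formulaMatrix k₁ n₁ k₂ n₂ i j) ∧
      (IsRealOrthogonal (B.lorentzCoeff H) → ∀ s, c s = 1 ∨ c s = -1) := by
  choose c hc using LorentzCG.exists_scalars k₁ n₁ k₂ n₂ H (lorentzMap B k₁ n₁ k₂ n₂)
  -- Each block contains a basis vector, so every constant is detected by some column.
  have hj : ∀ s : spins k₁ k₂ × spins n₁ n₂, ∃ j : ColIndex k₁ n₁ k₂ n₂, j.1 = s := fun s => by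
    obtain ⟨l⟩ := nonempty_spins s.1 s.2
    obtain ⟨m⟩ := nonempty_weights l
    exact ⟨⟨s, l, m⟩, rfl⟩
  have hcoeff : ∀ i j, B.lorentzCoeff H i j = c j.1 * B.formulaMatrix k₁ n₁ k₂ n₂ i j := by
    intro i j
    rw [← lorentzCoeff_lorentzMap_eq_formula, lorentzCoeff, lorentzCoeff, B.sumBasis_apply', hc,
      map_smul]
    rfl
  refine ⟨c, fun s h0 => ?_, hcoeff, fun hH s => ?_⟩
  · obtain ⟨j, rfl⟩ := hj s
    have h1 : H (B.sumBasis k₁ n₁ k₂ n₂ j) = 0 := by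
      rw [B.sumBasis_apply', hc, h0, zero_smul]
    have h2 : B.sumBasis k₁ n₁ k₂ n₂ j = 0 := by
      rw [← H.symm_apply_apply (B.sumBasis k₁ n₁ k₂ n₂ j), h1, map_zero]
    exact (B.sumBasis k₁ n₁ k₂ n₂).ne_zero j h2
  · obtain ⟨j, rfl⟩ := hj s
    have h1 := congrFun (congrFun hH.2.1 j) j
    have h2 := isRealOrthogonal_lorentzCoeff B k₁ n₁ k₂ n₂
    rw [lorentzCoeff_lorentzMap_eq_formula] at h2
    have h3 := congrFun (congrFun h2.2.1 j) j
    rw [Matrix.mul_apply, Matrix.one_apply_eq] at h1 h3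
    simp only [Matrix.transpose_apply, hcoeff] at h1 h3
    -- Column `j` has square sum one in both matrices, and the two columns differ by the factor `c
    -- j.1`.
    have h4 : c j.1 * c j.1 = 1 := by
      rw [← h1, ← mul_one (c j.1 * c j.1), ← h3, Finset.mul_sum]
      exact Finset.sum_congr rfl fun i _ => by ring
    exact mul_self_eq_one_iff.1 h4

end LorentzCG

end

theorem mainTheorem2 :
    -- orthogonal Clebsch–Gordan maps of `SU(2)` exist
    Nonempty LorentzCG.CGChoice ∧
    -- and for every choice of them
    ∀ B : LorentzCG.CGChoice,
      -- the coefficients vanish unless `m₁ + m₂ = m`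
      (∀ (a b c : ℕ) (p q r : ℤ), p + q ≠ r → B.coeff a p b q c r = 0) ∧
      -- the inverse map has the same coefficients
      (∀ (a b : ℕ) (p : LorentzCG.weights a) (q : LorentzCG.weights b)
        (j : Σ c : LorentzCG.spins a b, LorentzCG.weights c),
        (LorentzCG.sumBasis a b).repr
          ((B.map a b).symm (LorentzCG.prodBasis a b (p, q))) j =
            B.coeff a p b q j.1 j.2) ∧
      -- the vectors `e^{(k,n)}_{l,m}` are transformed by `SU(2)` as the vectors `e_{l,m}`
      (∀ (k n : ℕ) (u : LorentzCG.SU2) (l : LorentzCG.spins k n) (m : LorentzCG.weights l),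
        LorentzCG.TRep k n (LorentzCG.incl u) (B.basis k n ⟨l, m⟩) =
          ∑ m' : LorentzCG.weights l,
            (LorentzCG.spinBasis l).repr
              (LorentzCG.su2Rep l u (LorentzCG.spinBasis l m)) m' • B.basis k n ⟨l, m'⟩) ∧
      ∀ k₁ n₁ k₂ n₂ : ℕ,
        -- there is a Clebsch–Gordan map of the Lorentz group whose coefficients are given
        -- by the formula
        (∃ H : LorentzCG.LorentzCGMap k₁ n₁ k₂ n₂,
          B.lorentzCoeff H = B.formulaMatrix k₁ n₁ k₂ n₂) ∧
        -- it is orthogonal in the canonical bases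
        LorentzCG.IsRealOrthogonal (B.formulaMatrix k₁ n₁ k₂ n₂) ∧
        -- any other one differs from it by a factor for each `(k, n)`, which is a sign if the
        -- map is orthogonal
        (∀ H : LorentzCG.LorentzCGMap k₁ n₁ k₂ n₂,
          ∃ c : LorentzCG.spins k₁ k₂ × LorentzCG.spins n₁ n₂ → ℂ,
            (∀ s, c s ≠ 0) ∧
            (∀ i j, B.lorentzCoeff H i j = c j.1 * B.formulaMatrix k₁ n₁ k₂ n₂ i j) ∧
            (LorentzCG.IsRealOrthogonal (B.lorentzCoeff H) → ∀ s, c s = 1 ∨ c s = -1)) ∧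
        -- the coefficients vanish unless `m₁ + m₂ = m`
        (∀ (i : LorentzCG.RowIndex k₁ n₁ k₂ n₂) (j : LorentzCG.ColIndex k₁ n₁ k₂ n₂),
          (i.1.2 : ℤ) + (i.2.2 : ℤ) ≠ (j.2.2 : ℤ) →
            B.formulaMatrix k₁ n₁ k₂ n₂ i j = 0) := by
  refine ⟨LorentzCG.nonempty_cgChoice, fun B => ⟨fun a b c p q r h => B.coeff_eq_zero_of_ne h,
    fun a b p q j => B.repr_symm a b p q j, fun k n u l m => B.TRep_basis k n u l m,
    fun k₁ n₁ k₂ n₂ => ⟨⟨LorentzCG.lorentzMap B k₁ n₁ k₂ n₂,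
      LorentzCG.lorentzCoeff_lorentzMap_eq_formula B k₁ n₁ k₂ n₂⟩, ?_,
      fun H => B.exists_scalars k₁ n₁ k₂ n₂ H,
      fun i j h => B.formulaMatrix_eq_zero k₁ n₁ k₂ n₂ i j h⟩⟩⟩
  rw [← LorentzCG.lorentzCoeff_lorentzMap_eq_formula]
  exact LorentzCG.isRealOrthogonal_lorentzCoeff B k₁ n₁ k₂ n₂
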